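/- Let $n\ge 1$ be an integer and let $\Lambda$ be an Artin algebra, i.e. an algebra over a commutative artinian ring $R$ that is finitely generated as an $R$-module. Write $\mathrm{Mod}\text{-}\Lambda$ for the category of all left $\Lambda$-modules and $\mathrm{mod}\text{-}\Lambda$ for the category of finitely generated left $\Lambda$-modules. For a full subcategory $\mathcal M$ of an abelian category $\mathcal A$, say that $\mathcal M$ is $n$-cluster tilting in $\mathcal A$ if - every object of $\mathcal A$ is a quotient of an object of $\mathcal M$ and a subobject of an object of $\mathcal M$; - $\mathcal M$ is functorially finite in $\mathcal A$: for every $A\in\mathcal A$ there is a morphism $M\to A$ with $M\in\mathcal M$ through which every morphism from an object of $\mathcal M$ to $A$ factors, and dually a morphism $A\to M'$ with $M'\in\mathcal M$ through which every morphism from $A$ to an object of $\mathcal M$ factors; - $\mathcal M=\{X\in\mathcal A\mid \mathrm{Ext}^i_{\mathcal A}(X,\mathcal M)=0 \text{ for all } 1\le i\le n-1\}=\{X\in\mathcal A\mid \mathrm{Ext}^i_{\mathcal A}(\mathcal M,X)=0 \text{ for all } 1\le i\le n-1\}$. Let $M$ be a finitely generated left $\Lambda$-module. Let $\mathrm{Add}(M)\subseteq\mathrm{Mod}\text{-}\Lambda$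 be the full subcategory of direct summands of arbitrary direct sums of copies of $M$, and let $\mathrm{add}(M)\subseteq\mathrm{mod}\text{-}\Lambda$ be the full subcategory of direct summands of finite direct sums of copies of $M$. Then $\mathrm{Add}(M)$ is an $n$-cluster tilting subcategory of $\mathrm{Mod}\text{-}\Lambda$ if and only if $\mathrm{add}(M)$ is an $n$-cluster tilting subcategory of $\mathrm{mod}\text{-}\Lambda$. -/

import Mathlib

open CategoryTheory CategoryTheory.Limits CategoryTheory.Abelian

universe w v u

namespace ClusterTilting

section Approximations

variable {C : Type u} [Category.{v} C]

/-- A morphism `f : M ⟶ A` is a right `P`-approximation of `A` if `M` lies in `P` and every morphism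
`N ⟶ A` with `N` in `P` factors through `f`, i.e. `Hom(N, M) → Hom(N, A) → 0` is exact. -/
def IsRightApproximation (P : ObjectProperty C) {M A : C} (f : M ⟶ A) : Prop :=
  P M ∧ ∀ N : C, P N → ∀ g : N ⟶ A, ∃ h : N ⟶ M, h ≫ f = g

/-- A morphism `f : A ⟶ M` is a left `P`-approximation of `A` if `M` lies in `P` and every morphism
`A ⟶ N` with `N` in `P` factors through `f`. -/
def IsLeftApproximation (P : ObjectProperty C) {A M : C} (f : A ⟶ M) : Prop :=
  P M ∧ ∀ N : C, P N → ∀ g : A ⟶ N, ∃ h : M ⟶ N, f ≫ h = g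

/-- Every object has a right `P`-approximation. -/
def IsContravariantlyFinite (P : ObjectProperty C) : Prop :=
  ∀ A : C, ∃ (M : C) (f : M ⟶ A), IsRightApproximation P f

/-- Every object has a left `P`-approximation. -/
def IsCovariantlyFinite (P : ObjectProperty C) : Prop :=
  ∀ A : C, ∃ (M : C) (f : A ⟶ M), IsLeftApproximation P f

/-- Covariantly and contravariantly finite full subcategories. -/
def IsFunctoriallyFinite (P : ObjectProperty C) : Prop :=
  IsCovariantlyFinite P ∧ IsContravariantlyFinite P

/-- Every object is a quotient of an object of `P`. -/
def IsGenerating (P : ObjectProperty C) : Prop :=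
  ∀ X : C, ∃ (Y : C) (f : Y ⟶ X), P Y ∧ Epi f

/-- Every object embeds into an object of `P`. -/
def IsCogenerating (P : ObjectProperty C) : Prop :=
  ∀ X : C, ∃ (Y : C) (f : X ⟶ Y), P Y ∧ Mono f

end Approximations

/-- The full subcategory of an abelian category given by `P` is `n`-cluster tilting:
it is generating-cogenerating, functorially finite, and it consists exactly of the objects `X` with
`Ext^i(X, P) = 0` for all `1 ≤ i ≤ n - 1`, and exactly of the objects `X` with
`Ext^i(P, X) = 0` for all `1 ≤ i ≤ n - 1`. -/
structure IsNClusterTilting {C : Type u} [Category.{v} C] [Abelian C] [HasExt.{w} C]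
    (n : ℕ) (P : ObjectProperty C) : Prop where
  generating : IsGenerating P
  cogenerating : IsCogenerating P
  functoriallyFinite : IsFunctoriallyFinite P
  mem_iff_ext_left : ∀ X : C,
    P X ↔ ∀ i : ℕ, 1 ≤ i → i < n → ∀ Y : C, P Y → Subsingleton (Ext.{w} X Y i)
  mem_iff_ext_right : ∀ X : C,
    P X ↔ ∀ i : ℕ, 1 ≤ i → i < n → ∀ Y : C, P Y → Subsingleton (Ext.{w} Y X i)

/-- `Add(𝒳)`: the direct summands of arbitrary (set-indexed) direct sums of objects of `𝒳`. -/
def BigAdd {C : Type u} [Category.{v} C] [Abelian C] [HasCoproducts.{v} C]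
    (𝒳 : ObjectProperty C) : ObjectProperty C :=
  fun X => ∃ (Z : C) (I : Type v) (Y : I → C),
    (∀ i, 𝒳 (Y i)) ∧ Nonempty (X ⊞ Z ≅ ∐ Y)

/-- `add(𝒳)`: the direct summands of finite direct sums of objects of `𝒳`. -/
def SmallAdd {C : Type u} [Category.{v} C] [Abelian C]
    (𝒳 : ObjectProperty C) : ObjectProperty C :=
  fun X => ∃ (Z : C) (k : ℕ) (Y : Fin k → C),
    (∀ i, 𝒳 (Y i)) ∧ Nonempty (X ⊞ Z ≅ ∐ Y)

/-- An Artin algebra: an algebra, finitely generated as a module, over a commutative artinian ring.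
-/
class IsArtinAlgebra (R : Type w) (Λ : Type u) [CommRing R] [Ring Λ] [Algebra R Λ] : Prop where
  artinian : IsArtinianRing R
  finite : Module.Finite R Λ

theorem IsArtinAlgebra.isNoetherianRing (R : Type w) (Λ : Type u) [CommRing R] [Ring Λ]
    [Algebra R Λ] [h : IsArtinAlgebra R Λ] : IsNoetherianRing Λ := by
  have := h.artinian
  have := h.finite
  exact IsNoetherianRing.of_finite R Λ

section FinitelyGenerated

variable (Λ : Type u) [Ring Λ] [IsNoetherianRing Λ]

instance enoughProjectives_fgModuleCat : EnoughProjectives (FGModuleCat.{u} Λ) where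
  presentation X := by
    obtain ⟨k, f, hf⟩ := Module.Finite.exists_fin' Λ X
    have hproj : Projective (FGModuleCat.of Λ (Fin k → Λ)) := by
      refine ⟨fun {E Y} g e he => ?_⟩
      have he' : Epi ((forget₂ (FGModuleCat.{u} Λ) (ModuleCat.{u} Λ)).map e) := inferInstance
      have hsurj : Function.Surjective e.hom.hom := (ModuleCat.epi_iff_surjective _).1 he'
      obtain ⟨l, hl⟩ := Module.projective_lifting_property e.hom.hom g.hom.hom hsurj
      exact ⟨FGModuleCat.ofHom l, FGModuleCat.hom_ext hl⟩
    have hepi : Epi (FGModuleCat.ofHom f : FGModuleCat.of Λ (Fin k → Λ) ⟶ X) := by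
      apply (forget₂ (FGModuleCat.{u} Λ) (ModuleCat.{u} Λ)).epi_of_epi_map
      exact (ModuleCat.epi_iff_surjective _).2 hf
    exact ⟨{ p := _, projective := hproj, f := _, epi := hepi }⟩

instance hasExt_fgModuleCat : HasExt.{u} (FGModuleCat.{u} Λ) :=
  hasExt_of_enoughProjectives.{u} (FGModuleCat.{u} Λ)

end FinitelyGenerated

end ClusterTilting

/-!
Write `Add(M)` for the summands of arbitrary direct sums of copies of `M` and `add(M)` for the
summands of finite ones. A finitely generated module lies in `Add(M)` if and only if it lies in
`add(M)`, and `Ext` between finitely generated modules is the same in both categories.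

The finiteness input is that `M` has finite length over `R`, so that its positive-primitive
subgroups, being `R`-submodules, satisfy the descending chain condition
(`hasStationaryEvals_of_isArtinian`). The condition passes to direct sums of copies of `M` and to
their pure submodules, and a module satisfying it splits off from every module in which it is pure
(`IsPureMono.exists_retraction`, by Zorn's lemma on partial retractions). Two consequences are used.

* The direct sum of copies of `M` is a summand of the product. Hence `Ext(X, M) = 0` implies
  `Ext(X, N) = 0` for all `N` in `Add(M)` (`subsingleton_ext_bigAdd_right`).
* If every map from a finitely generated module to `X` factors through `add(M)`, then `X` lies in
  `Add(M)` (`isBigAddSummand_of_factors`).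

The first consequence and its easier dual identify the `Ext` conditions for `Add(M)` with those for
`M`, which gives the passage from `Add(M)` to `add(M)`; approximations in the finitely generated
modules come from finite generation of `Hom` over `R`.

Conversely, let `add(M)` be `n`-cluster tilting and suppose `Ext^i(M, X) = 0` for `1 ≤ i < n`. A
finitely generated module `F` has a coresolution of length `n - 1` by modules in `add(M)` obtained
from left approximations, and shifting along it the obstruction to extending a map `F → X` to the
first term lies in `Ext^(n-1)(N, X)` with `N` in `add(M)`, so it vanishes; for `n = 1` already `F`
lies in `add(M)`. By the second consequence `X` lies in `Add(M)` (`bigAdd_of_ext_eq_zero`).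
Injective modules and products of copies of `M` satisfy this criterion, which yields cogeneration
and left approximations. The criterion with `Ext^i(X, M) = 0` is deduced from it by repeatedly
passing to kernels of right approximations (`mem_of_ext_left_of_mem_of_ext_right`).
-/

namespace ClusterTilting

/-! ### Pure submodules that split off -/

section Retraction

variable {Λ : Type u} [Ring Λ]

/-- The values at `q` of the linear maps `F → K` vanishing on `F ∩ L`. It is meant for `q ∈ F`; for
finitely generated `F` over a noetherian ring these are the subgroups of `K` defined by
positive-primitive formulas. -/
def evalSet (K : Type*) [AddCommGroup K] [Module Λ K] {W : Type*} [AddCommGroup W] [Module Λ W]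
    (L : Submodule Λ W) (q : W) (F : Submodule Λ W) : Set K :=
  {k | ∃ h : F →ₗ[Λ] K, (∀ x : F, x.1 ∈ L → h x = 0) ∧ ∀ hq : q ∈ F, h ⟨q, hq⟩ = k}

lemma evalSet_anti {K : Type*} [AddCommGroup K] [Module Λ K] {W : Type*} [AddCommGroup W]
    [Module Λ W] {L : Submodule Λ W} {q : W} {F F' : Submodule Λ W} (h : F ≤ F') (hq : q ∈ F) :
    evalSet K L q F' ⊆ evalSet K L q F := by
  rintro k ⟨g, hg, hk⟩
  exact ⟨g ∘ₗ Submodule.inclusion h, fun x hx => hg _ hx, fun _ => hk (h hq)⟩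

variable (Λ) in
/-- For all `L` and `q`, the sets `evalSet K L q F` become constant for large finitely generated
`F`. This follows from the descending chain condition on positive-primitive subgroups, which
characterises the Σ-pure-injective modules. -/
def HasStationaryEvals (K : Type u) [AddCommGroup K] [Module Λ K] : Prop :=
  ∀ (W : Type u) [AddCommGroup W] [Module Λ W] (L : Submodule Λ W) (q : W),
    ∃ F₀ : Submodule Λ W, F₀.FG ∧ q ∈ F₀ ∧
      ∀ F : Submodule Λ W, F.FG → F₀ ≤ F → evalSet K L q F₀ ⊆ evalSet K L q F

/-- On every finitely generated submodule `F` of `W` there is a map to `K` retracting the part of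
`K` lying in `F`. Over a noetherian ring this says that `i` is a pure monomorphism. -/
def IsPureMono {K W : Type*} [AddCommGroup K] [Module Λ K] [AddCommGroup W] [Module Λ W]
    (i : K →ₗ[Λ] W) : Prop :=
  ∀ F : Submodule Λ W, F.FG → ∃ h : F →ₗ[Λ] K, ∀ (k : K) (hk : i k ∈ F), h ⟨i k, hk⟩ = k

lemma IsPureMono.injective {K W : Type*} [AddCommGroup K] [Module Λ K] [AddCommGroup W]
    [Module Λ W] {i : K →ₗ[Λ] W} (hi : IsPureMono i) : Function.Injective i := by
  refine (injective_iff_map_eq_zero i).2 fun k hk => ?_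
  obtain ⟨h, hh⟩ := hi ⊥ Submodule.fg_bot
  rw [← hh k (by simp [hk])]
  exact (congrArg h (Subtype.ext hk)).trans (map_zero h)

/-- The partial map `f` agrees on every finitely generated submodule `F` with some linear map
defined on all of `F`; no compatibility between the maps for different `F` is required. -/
def LocallyExtends {K W : Type*} [AddCommGroup K] [Module Λ K] [AddCommGroup W] [Module Λ W]
    (f : W →ₗ.[Λ] K) : Prop :=
  ∀ F : Submodule Λ W, F.FG → ∃ h : F →ₗ[Λ] K,
    ∀ (x : W) (hx : x ∈ F) (hd : x ∈ f.domain), h ⟨x, hx⟩ = f ⟨x, hd⟩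

lemma LocallyExtends.sSup [IsNoetherianRing Λ] {K W : Type*} [AddCommGroup K] [Module Λ K]
    [AddCommGroup W] [Module Λ W] {c : Set (W →ₗ.[Λ] K)} (hc : IsChain (· ≤ ·) c)
    (hne : c.Nonempty) (h : ∀ f ∈ c, LocallyExtends f) :
    LocallyExtends (LinearPMap.sSup c hc.directedOn) := by
  intro F hF
  have : IsNoetherian Λ F := isNoetherian_of_fg_of_noetherian F hF
  -- The part of `F` in the union is finitely generated, so it lies in one member of the chain.
  have key : ∃ f ∈ c, F ⊓ (LinearPMap.sSup c hc.directedOn).domain ≤ f.domain := by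
    have hfg : (F ⊓ (LinearPMap.sSup c hc.directedOn).domain).FG :=
      (isNoetherian_submodule.1 ‹_›) _ inf_le_left
    obtain ⟨s, hs⟩ := hfg
    have hs' : ∀ x ∈ s, ∃ f ∈ c, x ∈ f.domain := fun x hx =>
      (LinearPMap.mem_domain_sSup_iff hne _).1
        ((hs.le.trans inf_le_right) (Submodule.subset_span hx))
    have : ∃ f ∈ c, ∀ x ∈ s, x ∈ f.domain := by
      clear hs
      induction s using Finset.cons_induction with
      | empty => obtain ⟨f, hf⟩ := hne; exact ⟨f, hf, by simp⟩
      | cons a s ha ih =>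
        obtain ⟨f, hf, h1⟩ := ih fun x hx => hs' x (Finset.mem_cons_of_mem hx)
        obtain ⟨g, hg, h2⟩ := hs' a (Finset.mem_cons_self a s)
        obtain ⟨k, hk, hfk, hgk⟩ := hc.directedOn f hf g hg
        refine ⟨k, hk, fun x hx => ?_⟩
        rcases Finset.mem_cons.1 hx with rfl | hx
        · exact hgk.1 h2
        · exact hfk.1 (h1 x hx)
    obtain ⟨f, hf, h1⟩ := this
    exact ⟨f, hf, hs ▸ Submodule.span_le.2 h1⟩
  obtain ⟨f, hf, hle⟩ := key
  obtain ⟨g, hg⟩ := h f hf F hF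
  refine ⟨g, fun x hx hd => ?_⟩
  rw [hg x hx (hle ⟨hx, hd⟩)]
  exact (LinearPMap.sSup_apply hc.directedOn hf ⟨x, hle ⟨hx, hd⟩⟩).symm

/-- The extension step of the Zorn argument: stationarity provides one value at `q` that is
compatible with extensions to all finitely generated submodules at once. -/
lemma LocallyExtends.exists_extend [IsNoetherianRing Λ] {K W : Type u} [AddCommGroup K]
    [Module Λ K] (hK : HasStationaryEvals Λ K) [AddCommGroup W] [Module Λ W] {f : W →ₗ.[Λ] K}
    (hf : LocallyExtends f) (q : W) : ∃ g, f ≤ g ∧ q ∈ g.domain ∧ LocallyExtends g := by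
  obtain ⟨F₀, hF₀, hq, hst⟩ := hK W f.domain q
  obtain ⟨h₀, hh₀⟩ := hf F₀ hF₀
  set k := h₀ ⟨q, hq⟩ with hk
  -- By stationarity the value `k` at `q` is realised by an extension on every larger `F`.
  have key : ∀ F : Submodule Λ W, F.FG → F₀ ≤ F → ∃ h : F →ₗ[Λ] K,
      (∀ (x : W) (hx : x ∈ F) (hd : x ∈ f.domain), h ⟨x, hx⟩ = f ⟨x, hd⟩) ∧
        ∀ hq : q ∈ F, h ⟨q, hq⟩ = k := by
    intro F hF hle
    obtain ⟨h, hh⟩ := hf F hF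
    obtain ⟨d, hd, hdq⟩ := hst F hF hle (show k - h ⟨q, hle hq⟩ ∈ _ from
      ⟨h₀ - h ∘ₗ Submodule.inclusion hle, fun x hx => by
        have := hh₀ x x.2 hx
        have h2 := hh x (hle x.2) hx
        simp only [LinearMap.sub_apply, LinearMap.comp_apply, Submodule.inclusion_apply] at *
        rw [this, h2, sub_self], fun _ => rfl⟩)
    refine ⟨h + d, fun x hx hxd => ?_, fun hq' => ?_⟩
    · rw [LinearMap.add_apply, hh x hx hxd, hd ⟨x, hx⟩ hxd, add_zero]
    · rw [LinearMap.add_apply, hdq hq']; abel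
  have hspan : ∀ c : Λ, c • q = 0 → (RingHom.id Λ) c • k = 0 := by
    intro c hc
    rw [RingHom.id_apply, hk, ← map_smul]
    exact (congrArg h₀ (Subtype.ext hc)).trans (map_zero h₀)
  have hcompat : ∀ (x : f.domain) (y : (LinearPMap.mkSpanSingleton' q k hspan).domain),
      (x : W) = y → f x = LinearPMap.mkSpanSingleton' q k hspan y := by
    rintro ⟨x, hx⟩ ⟨y, hy⟩ (rfl : x = y)
    obtain ⟨c, rfl⟩ := Submodule.mem_span_singleton.1 hy
    rw [LinearPMap.mkSpanSingleton'_apply, ← hh₀ _ (F₀.smul_mem c hq) hx, RingHom.id_apply, hk,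
      ← map_smul]
    rfl
  refine ⟨f.sup _ hcompat, LinearPMap.left_le_sup _ _ _,
    (LinearPMap.right_le_sup f _ hcompat).1 (Submodule.mem_span_singleton_self q), ?_⟩
  intro F hF
  have : IsNoetherian Λ F := isNoetherian_of_fg_of_noetherian F hF
  have hfg : (F ⊓ (f.sup _ hcompat).domain).FG := (isNoetherian_submodule.1 ‹_›) _ inf_le_left
  obtain ⟨s, hs⟩ := hfg
  have hmem : ∀ x ∈ s, ∃ y ∈ f.domain, ∃ c : Λ, y + c • q = x := by
    intro x hx
    have h1 : x ∈ f.domain ⊔ Submodule.span Λ {q} :=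
      (hs.le.trans inf_le_right) (Submodule.subset_span hx)
    obtain ⟨y, hy, z, hz, rfl⟩ := Submodule.mem_sup.1 h1
    obtain ⟨c, rfl⟩ := Submodule.mem_span_singleton.1 hz
    exact ⟨y, hy, c, rfl⟩
  choose! y hy c hyc using hmem
  have hbig : (F ⊔ F₀).FG := hF.sup hF₀
  obtain ⟨h, hh, hhq⟩ := key (F ⊔ F₀) hbig le_sup_right
  refine ⟨h ∘ₗ Submodule.inclusion le_sup_left, fun x hx hd => ?_⟩
  -- Two linear maps on `F ⊓ dom` agree because they agree on generators.
  have hx' : x ∈ Submodule.span Λ (s : Set W) := hs ▸ ⟨hx, hd⟩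
  have hle : Submodule.span Λ (s : Set W) ≤ (f.sup _ hcompat).eqLocus ⟨F ⊔ F₀, h⟩ := by
    refine Submodule.span_le.2 fun z hz => ?_
    have hzF : z ∈ F ⊓ (f.sup _ hcompat).domain := hs ▸ Submodule.subset_span hz
    have hzF' : z ∈ F ⊔ F₀ := le_sup_left (a := F) hzF.1
    have hcq : c z • q ∈ F ⊔ F₀ := (F ⊔ F₀).smul_mem _ (le_sup_right (a := F) hq)
    have hyF : y z ∈ F ⊔ F₀ := by
      rw [eq_sub_of_add_eq (hyc z hz)]
      exact sub_mem hzF' hcq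
    have hzd : z ∈ (f.sup _ hcompat).domain := hzF.2
    refine ⟨hzd, hzF', (LinearPMap.sup_apply hcompat ⟨y z, hy z hz⟩ ⟨c z • q,
      Submodule.smul_mem _ _ (Submodule.mem_span_singleton_self q)⟩ ⟨z, hzd⟩
      (hyc z hz)).trans ?_⟩
    rw [LinearPMap.mkSpanSingleton'_apply, ← hh _ hyF, RingHom.id_apply,
      ← hhq (le_sup_right (a := F) hq), ← map_smul, ← map_add]
    exact congrArg h (Subtype.ext (hyc z hz))
  obtain ⟨h1, h2, h3⟩ := hle hx'
  exact h3.symm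

/-- A module with stationary evaluation sets is injective relative to pure monomorphisms. -/
theorem IsPureMono.exists_retraction [IsNoetherianRing Λ] {K W : Type u} [AddCommGroup K]
    [Module Λ K] (hK : HasStationaryEvals Λ K) [AddCommGroup W] [Module Λ W] {i : K →ₗ[Λ] W}
    (hi : IsPureMono i) : ∃ r : W →ₗ[Λ] K, r ∘ₗ i = LinearMap.id := by
  let f₀ : W →ₗ.[Λ] K :=
    ⟨LinearMap.range i, (LinearEquiv.ofInjective i hi.injective).symm.toLinearMap⟩
  have hf₀ : ∀ (k : K) (hk : i k ∈ f₀.domain), f₀ ⟨i k, hk⟩ = k := fun k hk =>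
    (LinearEquiv.ofInjective i hi.injective).symm_apply_apply k
  have hloc : LocallyExtends f₀ := by
    intro F hF
    obtain ⟨h, hh⟩ := hi F hF
    refine ⟨h, ?_⟩
    rintro _ hx ⟨k, rfl⟩
    exact (hh k hx).trans (hf₀ k _).symm
  obtain ⟨m, hm, hmax⟩ := zorn_le_nonempty₀ {f : W →ₗ.[Λ] K | LocallyExtends f}
    (fun c hc hchain y hy => ⟨LinearPMap.sSup c hchain.directedOn,
      LocallyExtends.sSup hchain ⟨y, hy⟩ fun f hf => hc hf,
      fun z hz => LinearPMap.le_sSup hchain.directedOn hz⟩) f₀ hloc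
  have htop : ∀ q, q ∈ m.domain := by
    intro q
    obtain ⟨g, hmg, hq, hg⟩ := LocallyExtends.exists_extend hK hmax.prop q
    exact (hmax.le_of_ge hg hmg).1 hq
  refine ⟨m.toFun ∘ₗ LinearMap.codRestrict m.domain LinearMap.id htop, ?_⟩
  ext k
  exact (hm.2 (x := ⟨i k, k, rfl⟩) (y := ⟨i k, htop _⟩) rfl).symm.trans (hf₀ k _)

/-- The evaluation sets of `M` are `R`-submodules, so one of them is minimal. -/
lemma hasStationaryEvals_of_isArtinian (R : Type w) [CommRing R] [Algebra R Λ] (M : Type u)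
    [AddCommGroup M] [Module Λ M] [Module R M] [IsScalarTower R Λ M] [IsArtinian R M] :
    HasStationaryEvals Λ M := by
  intro W _ _ L q
  have : SMulCommClass Λ R M := IsScalarTower.to_smulCommClass' 
  let V : {F : Submodule Λ W // F.FG ∧ q ∈ F} → Submodule R M := fun F =>
    { carrier := evalSet M L q F.1
      add_mem' := by
        rintro a b ⟨g, hg, ha⟩ ⟨h, hh, hb⟩
        exact ⟨g + h, fun x hx => by rw [LinearMap.add_apply, hg x hx, hh x hx, add_zero],
          fun hq => by rw [LinearMap.add_apply, ha hq, hb hq]⟩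
      zero_mem' := ⟨0, fun _ _ => rfl, fun _ => rfl⟩
      smul_mem' := by
        rintro c a ⟨g, hg, ha⟩
        exact ⟨c • g, fun x hx => by rw [LinearMap.smul_apply, hg x hx, smul_zero],
          fun hq => by rw [LinearMap.smul_apply, ha hq]⟩ }
  have hne : (Set.range V).Nonempty := ⟨_, ⟨⟨Submodule.span Λ {q}, Submodule.fg_span_singleton q,
    Submodule.mem_span_singleton_self q⟩, rfl⟩⟩
  obtain ⟨_, ⟨F₀, rfl⟩, hmin⟩ := WellFounded.has_min (wellFounded_lt (α := Submodule R M)) _ hne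
  refine ⟨F₀.1, F₀.2.1, F₀.2.2, fun F hF hle => ?_⟩
  have h1 : V ⟨F, hF, hle F₀.2.2⟩ ≤ V F₀ := evalSet_anti hle F₀.2.2
  have h2 := eq_of_le_of_not_lt h1 (hmin _ ⟨_, rfl⟩)
  exact fun k hk => h2.ge hk

lemma HasStationaryEvals.finsupp {M : Type u} [AddCommGroup M] [Module Λ M]
    (hM : HasStationaryEvals Λ M) (J : Type u) : HasStationaryEvals Λ (J →₀ M) := by
  intro W _ _ L q
  obtain ⟨F₀, hF₀, hq, hst⟩ := hM W L q
  refine ⟨F₀, hF₀, hq, fun F hF hle k hk => ?_⟩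
  obtain ⟨g, hg, hgk⟩ := hk
  have : ∀ j, k j ∈ evalSet M L q F := fun j => hst F hF hle
    ⟨Finsupp.lapply j ∘ₗ g, fun x hx => by simp [hg x hx], fun hq => by simp [hgk hq]⟩
  choose h hh hhk using this
  refine ⟨∑ j ∈ k.support, Finsupp.lsingle j ∘ₗ h j, fun x hx => ?_, fun hq' => ?_⟩
  · simp [LinearMap.sum_apply, hh _ x hx]
  · simp only [LinearMap.sum_apply, LinearMap.comp_apply, hhk _ hq', Finsupp.lsingle_apply]
    exact k.sum_single

/-- For a pure submodule `K` of `Q` the evaluation sets of `K` are the intersections of `K` with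
those of `Q`. -/
lemma IsPureMono.hasStationaryEvals [IsNoetherianRing Λ] {K Q : Type u} [AddCommGroup K]
    [Module Λ K] [AddCommGroup Q] [Module Λ Q] (hQ : HasStationaryEvals Λ Q) {i : K →ₗ[Λ] Q}
    (hi : IsPureMono i) : HasStationaryEvals Λ K := by
  intro W _ _ L q
  obtain ⟨F₀, hF₀, hq, hst⟩ := hQ W L q
  refine ⟨F₀, hF₀, hq, fun F hF hle k hk => ?_⟩
  obtain ⟨g, hg, hgk⟩ := hk
  obtain ⟨h, hh, hhk⟩ := hst F hF hle (show i k ∈ _ from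
    ⟨i ∘ₗ g, fun x hx => by simp [hg x hx], fun hq => by simp [hgk hq]⟩)
  have hFG : (LinearMap.range h).FG := by
    have : Module.Finite Λ F := Module.Finite.iff_fg.2 hF
    exact Module.Finite.iff_fg.1 inferInstance
  obtain ⟨r, hr⟩ := hi _ hFG
  refine ⟨r ∘ₗ h.rangeRestrict, fun x hx => ?_, fun hq' => ?_⟩
  · rw [LinearMap.comp_apply]
    exact (congrArg r (Subtype.ext (hh x hx))).trans (map_zero r)
  · have hmem : i k ∈ LinearMap.range h := ⟨_, hhk hq'⟩
    rw [← hr k hmem, LinearMap.comp_apply]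
    congr 1
    exact Subtype.ext (hhk hq')

/-- The elements of a finitely generated submodule that have finite support are supported on a
common finite set, and the projection to its coordinates fixes them. -/
lemma isPureMono_finsupp_pi (M : Type*) [AddCommGroup M] [Module Λ M] [IsNoetherianRing Λ]
    (J : Type*) : IsPureMono (Finsupp.lcoeFun : (J →₀ M) →ₗ[Λ] (J → M)) := by
  classical
  intro F hF
  have : IsNoetherian Λ F := isNoetherian_of_fg_of_noetherian F hF
  obtain ⟨s, hs⟩ : (F ⊓ LinearMap.range (Finsupp.lcoeFun : (J →₀ M) →ₗ[Λ] (J → M))).FG :=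
    (isNoetherian_submodule.1 ‹_›) _ inf_le_left
  -- Finitely many coordinates support all finitely supported elements of `F`.
  have hJ : ∃ T : Finset J, ∀ k : J →₀ M, ⇑k ∈ F → k.support ⊆ T := by
    have hs' : ∀ x ∈ s, ∃ k : J →₀ M, ⇑k = x := fun x hx =>
      (hs.le.trans inf_le_right) (Submodule.subset_span hx)
    choose! κ hκ using hs'
    refine ⟨s.biUnion fun x => (κ x).support, fun k hk => ?_⟩
    have h1 : ⇑k ∈ Submodule.span Λ (s : Set (J → M)) := hs ▸ ⟨hk, k, rfl⟩
    have h2 : Submodule.span Λ (s : Set (J → M)) ≤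
        ⨅ j ∈ {j | j ∉ s.biUnion fun x => (κ x).support}, LinearMap.ker (LinearMap.proj j) := by
      refine Submodule.span_le.2 fun x hx => ?_
      simp only [SetLike.mem_coe, Submodule.mem_iInf, LinearMap.mem_ker, LinearMap.proj_apply]
      intro j hj
      rw [← hκ x hx]
      by_contra hne
      exact hj (Finset.mem_biUnion.2 ⟨x, hx, Finsupp.mem_support_iff.2 hne⟩)
    intro j hj
    by_contra hnot
    have := h2 h1
    simp only [Submodule.mem_iInf, LinearMap.mem_ker, LinearMap.proj_apply] at this
    exact Finsupp.mem_support_iff.1 hj (this j hnot)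
  obtain ⟨T, hT⟩ := hJ
  refine ⟨(∑ j ∈ T, Finsupp.lsingle j ∘ₗ LinearMap.proj j) ∘ₗ F.subtype, fun k hk => ?_⟩
  simp only [LinearMap.comp_apply, LinearMap.sum_apply, LinearMap.proj_apply,
    Finsupp.lsingle_apply, Submodule.subtype_apply]
  exact (Finsupp.sum_of_support_subset k (hT k hk) _ (by simp)).symm.trans k.sum_single

/-! ### Retracts of direct sums of copies of a module -/

variable (Λ) in
/-- `X` is a retract of a direct sum of copies of `M`. -/
def IsBigAddSummand (M X : Type u) [AddCommGroup M] [Module Λ M] [AddCommGroup X] [Module Λ X] :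
    Prop :=
  ∃ (J : Type u) (s : X →ₗ[Λ] (J →₀ M)) (r : (J →₀ M) →ₗ[Λ] X), r ∘ₗ s = LinearMap.id

variable (Λ) in
/-- `X` is a retract of a finite power of `M`. -/
def IsSmallAddSummand (M X : Type u) [AddCommGroup M] [Module Λ M] [AddCommGroup X]
    [Module Λ X] : Prop :=
  ∃ (k : ℕ) (s : X →ₗ[Λ] (Fin k → M)) (r : (Fin k → M) →ₗ[Λ] X), r ∘ₗ s = LinearMap.id

variable (Λ) in
/-- The evaluation map from the direct sum of copies of `M` indexed by `Hom(M, X)` to `X`, given by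
`f` on the copy of `M` with index `f`. -/
noncomputable def evalSum (M X : Type u) [AddCommGroup M] [Module Λ M] [AddCommGroup X]
    [Module Λ X] : ((M →ₗ[Λ] X) →₀ M) →ₗ[Λ] X :=
  Finsupp.lsum ℕ fun f => f

lemma evalSum_single {M X : Type u} [AddCommGroup M] [Module Λ M] [AddCommGroup X] [Module Λ X]
    (f : M →ₗ[Λ] X) (m : M) : evalSum Λ M X (Finsupp.single f m) = f m := by
  simp [evalSum]

lemma exists_evalSum_comp_eq {M X : Type u} [AddCommGroup M] [Module Λ M] [AddCommGroup X]
    [Module Λ X] {k : ℕ} (b : (Fin k → M) →ₗ[Λ] X) :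
    ∃ t : (Fin k → M) →ₗ[Λ] ((M →ₗ[Λ] X) →₀ M), evalSum Λ M X ∘ₗ t = b := by
  refine ⟨∑ j, Finsupp.lsingle (b ∘ₗ LinearMap.single Λ (fun _ => M) j) ∘ₗ LinearMap.proj j, ?_⟩
  refine LinearMap.ext fun m => ?_
  conv_rhs => rw [← Finset.univ_sum_single m]
  simp [evalSum_single]

/-- If the inclusion of every finitely generated submodule of `X` factors through a finite power of
`M`, then the kernel of the evaluation map onto `X` is a pure submodule of a direct sum of copies of
`M`, so it splits off, and `X` is the complement. -/
theorem isBigAddSummand_of_factors [IsNoetherianRing Λ] {M X : Type u} [AddCommGroup M]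
    [Module Λ M] [AddCommGroup X] [Module Λ X] (hM : HasStationaryEvals Λ M)
    (hX : ∀ F : Submodule Λ X, F.FG → ∃ (k : ℕ) (a : F →ₗ[Λ] (Fin k → M))
      (b : (Fin k → M) →ₗ[Λ] X), b ∘ₗ a = F.subtype) :
    IsBigAddSummand Λ M X := by
  let p := evalSum Λ M X
  -- Finitely generated submodules of `X` lift along `p`.
  have hlift : ∀ F : Submodule Λ X, F.FG → ∃ t : F →ₗ[Λ] ((M →ₗ[Λ] X) →₀ M),
      ∀ x, p (t x) = x := by
    intro F hF
    obtain ⟨k, a, b, hab⟩ := hX F hF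
    obtain ⟨t, ht⟩ := exists_evalSum_comp_eq b
    exact ⟨t ∘ₗ a, fun x => (LinearMap.congr_fun ht (a x)).trans (LinearMap.congr_fun hab x)⟩
  have hsurj : Function.Surjective p := fun x => by
    obtain ⟨t, ht⟩ := hlift (Submodule.span Λ {x}) (Submodule.fg_span_singleton x)
    exact ⟨t ⟨x, Submodule.mem_span_singleton_self x⟩, ht _⟩
  have hpure : IsPureMono (LinearMap.ker p).subtype := by
    intro F hF
    obtain ⟨t, ht⟩ := hlift (F.map p) (hF.map p)
    refine ⟨LinearMap.codRestrict _ (F.subtype - t ∘ₗ p.submoduleMap F) fun x => ?_,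
      fun k hk => ?_⟩
    · simp [ht]
    · have h0 : p.submoduleMap F ⟨k, hk⟩ = 0 := Subtype.ext k.2
      ext1
      change (k : (M →ₗ[Λ] X) →₀ M) - t (p.submoduleMap F ⟨k, hk⟩) = (k : (M →ₗ[Λ] X) →₀ M)
      rw [h0, map_zero, sub_zero]
  obtain ⟨ρ, hρ⟩ := IsPureMono.exists_retraction
    (hpure.hasStationaryEvals (hM.finsupp (M →ₗ[Λ] X))) hpure
  have hker : LinearMap.ker p ≤ LinearMap.ker
      (LinearMap.id - (LinearMap.ker p).subtype ∘ₗ ρ) := fun y hy => by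
    have := LinearMap.congr_fun hρ ⟨y, hy⟩
    simp only [LinearMap.comp_apply, Submodule.subtype_apply, LinearMap.id_apply] at this
    simp [this]
  refine ⟨_, (LinearMap.ker p).liftQ _ hker ∘ₗ
    (p.quotKerEquivOfSurjective hsurj).symm.toLinearMap, p, ?_⟩
  ext x
  obtain ⟨y, rfl⟩ := hsurj x
  have h2 : (p.quotKerEquivOfSurjective hsurj).symm (p y) = (LinearMap.ker p).mkQ y :=
    (LinearEquiv.symm_apply_eq _).2 rfl
  simp [h2]

end Retraction

/-! ### Vanishing of Ext and dimension shifting -/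

section Homological

variable {C : Type u} [Category.{v} C] [Abelian C] [HasExt.{w} C]

lemma subsingleton_ext_of_forall_eq_zero {X Y : C} {n : ℕ} (h : ∀ e : Ext.{w} X Y n, e = 0) :
    Subsingleton (Ext.{w} X Y n) :=
  ⟨fun a b => (h a).trans (h b).symm⟩

lemma subsingleton_ext_of_retract_left {X X' Y : C} {n : ℕ} {s : X ⟶ X'} {r : X' ⟶ X}
    (h : s ≫ r = 𝟙 X) (hX' : Subsingleton (Ext.{w} X' Y n)) : Subsingleton (Ext.{w} X Y n) :=
  subsingleton_ext_of_forall_eq_zero fun e => by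
    rw [← Ext.mk₀_id_comp e, ← h, ← Ext.mk₀_comp_mk₀_assoc,
      Subsingleton.elim ((Ext.mk₀ r).comp e (zero_add n)) 0, Ext.comp_zero]

lemma subsingleton_ext_of_retract_right {X Y Y' : C} {n : ℕ} {s : Y ⟶ Y'} {r : Y' ⟶ Y}
    (h : s ≫ r = 𝟙 Y) (hY' : Subsingleton (Ext.{w} X Y' n)) : Subsingleton (Ext.{w} X Y n) :=
  subsingleton_ext_of_forall_eq_zero fun e => by
    rw [← Ext.comp_mk₀_id e, ← h, ← Ext.mk₀_comp_mk₀, ← Ext.comp_assoc_of_third_deg_zero,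
      Subsingleton.elim (e.comp (Ext.mk₀ s) (add_zero n)) 0, Ext.zero_comp]

variable {S : ShortComplex C} (hS : S.ShortExact)

include hS

lemma subsingleton_ext_X₃_left {Y : C} {n : ℕ} (h₁ : Subsingleton (Ext.{w} S.X₁ Y n))
    (h₂ : Subsingleton (Ext.{w} S.X₂ Y (n + 1))) : Subsingleton (Ext.{w} S.X₃ Y (n + 1)) :=
  subsingleton_ext_of_forall_eq_zero fun e => by
    obtain ⟨x, rfl⟩ := Ext.contravariant_sequence_exact₃ hS Y e (Subsingleton.elim _ _)
      (add_comm 1 n)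
    rw [Subsingleton.elim x 0, Ext.comp_zero]

lemma subsingleton_ext_X₁_left {Y : C} {n : ℕ} (h₂ : Subsingleton (Ext.{w} S.X₂ Y n))
    (h₃ : Subsingleton (Ext.{w} S.X₃ Y (n + 1))) : Subsingleton (Ext.{w} S.X₁ Y n) :=
  subsingleton_ext_of_forall_eq_zero fun e => by
    obtain ⟨x, rfl⟩ := Ext.contravariant_sequence_exact₁ hS Y e (add_comm 1 n)
      (Subsingleton.elim _ _)
    rw [Subsingleton.elim x 0, Ext.comp_zero]

lemma subsingleton_ext_X₁_right {X : C} {n : ℕ} (h₃ : Subsingleton (Ext.{w} X S.X₃ n))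
    (h₂ : Subsingleton (Ext.{w} X S.X₂ (n + 1))) : Subsingleton (Ext.{w} X S.X₁ (n + 1)) :=
  subsingleton_ext_of_forall_eq_zero fun e => by
    obtain ⟨x, rfl⟩ := Ext.covariant_sequence_exact₁ X hS e (Subsingleton.elim _ _) rfl
    rw [Subsingleton.elim x 0, Ext.zero_comp]

lemma subsingleton_ext_X₃_right {X : C} {n : ℕ} (h₂ : Subsingleton (Ext.{w} X S.X₂ n))
    (h₁ : Subsingleton (Ext.{w} X S.X₁ (n + 1))) : Subsingleton (Ext.{w} X S.X₃ n) :=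
  subsingleton_ext_of_forall_eq_zero fun e => by
    obtain ⟨x, rfl⟩ := Ext.covariant_sequence_exact₃ X hS e rfl (Subsingleton.elim _ _)
    rw [Subsingleton.elim x 0, Ext.zero_comp]

lemma exists_lift_of_subsingleton_ext {X : C} (h : Subsingleton (Ext.{w} X S.X₁ 1))
    (f : X ⟶ S.X₃) : ∃ g : X ⟶ S.X₂, g ≫ S.g = f := by
  obtain ⟨x, hx⟩ := Ext.covariant_sequence_exact₃ X hS (Ext.mk₀ f) (zero_add 1)
    (Subsingleton.elim _ _)
  obtain ⟨g, rfl⟩ := Ext.addEquiv₀.symm.surjective x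
  exact ⟨g, Ext.addEquiv₀.symm.injective (by simpa using hx)⟩

lemma exists_extension_of_subsingleton_ext {Y : C} (h : Subsingleton (Ext.{w} S.X₃ Y 1))
    (f : S.X₁ ⟶ Y) : ∃ g : S.X₂ ⟶ Y, S.f ≫ g = f := by
  obtain ⟨x, hx⟩ := Ext.contravariant_sequence_exact₁ hS Y (Ext.mk₀ f) (add_zero 1)
    (Subsingleton.elim _ _)
  obtain ⟨g, rfl⟩ := Ext.addEquiv₀.symm.surjective x
  exact ⟨g, Ext.addEquiv₀.symm.injective (by simpa using hx)⟩

lemma subsingleton_ext_one_of_lift {X : C} (h₂ : Subsingleton (Ext.{w} X S.X₂ 1))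
    (h : ∀ f : X ⟶ S.X₃, ∃ g : X ⟶ S.X₂, g ≫ S.g = f) : Subsingleton (Ext.{w} X S.X₁ 1) :=
  subsingleton_ext_of_forall_eq_zero fun e => by
    obtain ⟨x, rfl⟩ := Ext.covariant_sequence_exact₁ X hS e (Subsingleton.elim _ _) (zero_add 1)
    obtain ⟨f, rfl⟩ := Ext.addEquiv₀.symm.surjective x
    obtain ⟨g, rfl⟩ := h f
    simp only [Ext.addEquiv₀_symm_apply, ← Ext.mk₀_comp_mk₀]
    rw [Ext.comp_assoc_of_second_deg_zero, hS.comp_extClass, Ext.comp_zero]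

lemma subsingleton_ext_one_of_extension {Y : C} (h₂ : Subsingleton (Ext.{w} S.X₂ Y 1))
    (h : ∀ f : S.X₁ ⟶ Y, ∃ g : S.X₂ ⟶ Y, S.f ≫ g = f) : Subsingleton (Ext.{w} S.X₃ Y 1) :=
  subsingleton_ext_of_forall_eq_zero fun e => by
    obtain ⟨x, rfl⟩ := Ext.contravariant_sequence_exact₃ hS Y e (Subsingleton.elim _ _)
      (add_zero 1)
    obtain ⟨f, rfl⟩ := Ext.addEquiv₀.symm.surjective x
    obtain ⟨g, rfl⟩ := h f
    simp only [Ext.addEquiv₀_symm_apply, ← Ext.mk₀_comp_mk₀]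
    rw [hS.extClass_comp_assoc]

omit hS

/-- `Ext` into `Y` turns vanishing on the summands into vanishing on the coproduct. Shifting along
an injective copresentation of `Y` reduces this to lifting maps out of the coproduct, so
exactness of coproducts is not needed. -/
lemma subsingleton_ext_cofan [EnoughInjectives C] {J : Type*} {X : J → C} {c : Cofan X}
    (hc : IsColimit c) (n : ℕ) (Y : C) (h : ∀ j, Subsingleton (Ext.{w} (X j) Y (n + 1))) :
    Subsingleton (Ext.{w} c.pt Y (n + 1)) := by
  induction n generalizing Y with
  | zero =>
    have hS : (ShortComplex.mk _ _ (cokernel.condition (Injective.ι Y))).ShortExact :=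
      { exact := ShortComplex.exact_cokernel (Injective.ι Y) }
    refine subsingleton_ext_one_of_lift hS (Ext.subsingleton_of_injective _ _ _) fun f => ?_
    choose g hg using fun j => exists_lift_of_subsingleton_ext hS (h j) (c.inj j ≫ f)
    exact ⟨Cofan.IsColimit.desc hc g, Cofan.IsColimit.hom_ext hc _ _ fun j => by
      rw [Cofan.IsColimit.fac_assoc, hg]⟩
  | succ n ih =>
    have hS : (ShortComplex.mk _ _ (cokernel.condition (Injective.ι Y))).ShortExact :=
      { exact := ShortComplex.exact_cokernel (Injective.ι Y) }
    exact subsingleton_ext_X₁_right hS (ih _ fun j => subsingleton_ext_X₃_right hS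
      (Ext.subsingleton_of_injective _ _ _) (h j)) (Ext.subsingleton_of_injective _ _ _)

/-- The dual of `subsingleton_ext_cofan`, by shifting along a projective presentation of `X`. -/
lemma subsingleton_ext_fan [EnoughProjectives C] {J : Type*} {Y : J → C} {c : Fan Y}
    (hc : IsLimit c) (n : ℕ) (X : C) (h : ∀ j, Subsingleton (Ext.{w} X (Y j) (n + 1))) :
    Subsingleton (Ext.{w} X c.pt (n + 1)) := by
  induction n generalizing X with
  | zero =>
    have hS : (ShortComplex.mk _ _ (kernel.condition (Projective.π X))).ShortExact :=
      { exact := ShortComplex.exact_kernel (Projective.π X) }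
    refine subsingleton_ext_one_of_extension hS (Ext.subsingleton_of_projective _ _ _)
      fun f => ?_
    choose g hg using fun j => exists_extension_of_subsingleton_ext hS (h j) (f ≫ c.proj j)
    exact ⟨Fan.IsLimit.lift hc g, Fan.IsLimit.hom_ext hc _ _ fun j => by
      rw [Category.assoc, Fan.IsLimit.fac, hg]⟩
  | succ n ih =>
    have hS : (ShortComplex.mk _ _ (kernel.condition (Projective.π X))).ShortExact :=
      { exact := ShortComplex.exact_kernel (Projective.π X) }
    exact subsingleton_ext_X₃_left hS (ih _ fun j => subsingleton_ext_X₁_left hS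
      (Ext.subsingleton_of_projective _ _ _) (h j)) (Ext.subsingleton_of_projective _ _ _)

/-- The right-hand `Ext` criterion for membership in `P` implies the left-hand one. Passing to the
kernel of a right approximation trades one degree of vanishing of `Ext(X, P)` for one more degree of
vanishing of `Ext(P, X)`; the case `j = n - 1` is the left-hand criterion. -/
lemma mem_of_ext_left_of_mem_of_ext_right {n : ℕ} {P : ObjectProperty C}
    (hret : ∀ {X Y : C} (s : X ⟶ Y) (r : Y ⟶ X), s ≫ r = 𝟙 X → P Y → P X)
    (happ : ∀ X : C, ∃ (Y : C) (f : Y ⟶ X), IsRightApproximation P f ∧ Epi f)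
    (hPP : ∀ X Y : C, P X → P Y → ∀ i, 1 ≤ i → i < n → Subsingleton (Ext.{w} X Y i))
    (hright : ∀ X : C, (∀ i, 1 ≤ i → i < n → ∀ Y, P Y → Subsingleton (Ext.{w} Y X i)) → P X)
    (j : ℕ) (hj : j < n) (X : C)
    (h₁ : ∀ i, 1 ≤ i → i + j < n → ∀ Y, P Y → Subsingleton (Ext.{w} Y X i))
    (h₂ : ∀ i, 1 ≤ i → i ≤ j → ∀ Y, P Y → Subsingleton (Ext.{w} X Y i)) : P X := by
  induction j generalizing X with
  | zero => exact hright X h₁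
  | succ j ih =>
    obtain ⟨M₀, f, ⟨hM₀, hf⟩, hepi⟩ := happ X
    have hS : (ShortComplex.mk _ _ (kernel.condition f)).ShortExact :=
      { exact := ShortComplex.exact_kernel f }
    have hK : P (kernel f) := by
      refine ih (by lia) _ (fun i hi hij Y hY => ?_) (fun i hi hij Y hY => ?_)
      · obtain rfl | ⟨i, rfl⟩ : i = 1 ∨ ∃ i', i = i' + 1 + 1 := by
          obtain rfl | hi := hi.eq_or_lt
          · exact Or.inl rfl
          · exact Or.inr ⟨i - 2, by lia⟩
        · exact subsingleton_ext_one_of_lift hS (hPP _ _ hY hM₀ _ le_rfl (by lia)) (hf Y hY)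
        · exact subsingleton_ext_X₁_right hS (h₁ (i + 1) (by lia) (by lia) Y hY)
            (hPP _ _ hY hM₀ _ (by lia) (by lia))
      · exact subsingleton_ext_X₁_left hS (hPP _ _ hM₀ hY i hi (by lia))
          (h₂ _ (by lia) (by lia) Y hY)
    obtain ⟨s, hs⟩ := exists_lift_of_subsingleton_ext hS (h₂ 1 le_rfl (by lia) _ hK) (𝟙 X)
    exact hret s f hs hM₀

/-- If `Ext(P, X)` vanishes in degrees `1, …, n - 1`, then for objects `A` of `G` (a class admitting
monic left `P`-approximations with cokernel in `G`) vanishing of `Ext(A, P)` in degrees `1, …, j`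
implies that of `Ext(A, X)`. By descending induction on `j`: for `j = n - 1` the object `A` lies in
`P`, and cokernels of left approximations increase `j`. -/
lemma subsingleton_ext_of_left_coresolution {n : ℕ} {P G : ObjectProperty C}
    (hG : ∀ A : C, G A → ∃ S : ShortComplex C, S.ShortExact ∧ S.X₁ = A ∧
      IsLeftApproximation P S.f ∧ G S.X₃)
    (hPP : ∀ X Y : C, P X → P Y → ∀ i, 1 ≤ i → i < n → Subsingleton (Ext.{w} X Y i))
    (hleft : ∀ A : C, G A →
      (∀ i, 1 ≤ i → i < n → ∀ Y, P Y → Subsingleton (Ext.{w} A Y i)) → P A)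
    {X : C} (hX : ∀ i, 1 ≤ i → i < n → ∀ Y, P Y → Subsingleton (Ext.{w} Y X i))
    (j : ℕ) (hj : j < n) (A : C) (hA : G A)
    (h : ∀ i, 1 ≤ i → i ≤ j → ∀ Y, P Y → Subsingleton (Ext.{w} A Y i)) :
    ∀ i, 1 ≤ i → i ≤ j → Subsingleton (Ext.{w} A X i) := by
  obtain ⟨d, hd⟩ : ∃ d, j + d + 1 = n := ⟨n - j - 1, by lia⟩
  induction d generalizing j A with
  | zero =>
    intro i hi hij
    exact hX i hi (by lia) A (hleft A hA fun i hi hin Y hY => h i hi (by lia) Y hY)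
  | succ d ih =>
    intro i hi hij
    obtain ⟨S, hS, rfl, ⟨hM₀, hf⟩, hG'⟩ := hG A hA
    refine subsingleton_ext_X₁_left hS (hX i hi (by lia) _ hM₀)
      (ih (j + 1) (by lia) S.X₃ hG' (fun i hi hij Y hY => ?_) (by lia) (i + 1) (by lia) (by lia))
    obtain rfl | ⟨i, rfl⟩ : i = 1 ∨ ∃ i', i = i' + 1 + 1 := by
      obtain rfl | hi := hi.eq_or_lt
      · exact Or.inl rfl
      · exact Or.inr ⟨i - 2, by lia⟩
    · exact subsingleton_ext_one_of_extension hS (hPP _ _ hM₀ hY _ le_rfl (by lia)) (hf Y hY)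
    · exact subsingleton_ext_X₃_left hS (h (i + 1) (by lia) (by lia) Y hY)
        (hPP _ _ hM₀ hY _ (by lia) (by lia))

/-- The obstruction to extending `f` along a left `P`-approximation of `A` lies in a vanishing
`Ext¹`. -/
lemma exists_factorization_of_ext_eq_zero {n : ℕ} (hn : 1 ≤ n) {P G : ObjectProperty C}
    (hG : ∀ A : C, G A → ∃ S : ShortComplex C, S.ShortExact ∧ S.X₁ = A ∧
      IsLeftApproximation P S.f ∧ G S.X₃)
    (hPP : ∀ X Y : C, P X → P Y → ∀ i, 1 ≤ i → i < n → Subsingleton (Ext.{w} X Y i))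
    (hleft : ∀ A : C, G A →
      (∀ i, 1 ≤ i → i < n → ∀ Y, P Y → Subsingleton (Ext.{w} A Y i)) → P A)
    {X : C} (hX : ∀ i, 1 ≤ i → i < n → ∀ Y, P Y → Subsingleton (Ext.{w} Y X i))
    {A : C} (hA : G A) (f : A ⟶ X) : ∃ (B : C) (a : A ⟶ B) (b : B ⟶ X), P B ∧ a ≫ b = f := by
  obtain rfl | hn : n = 1 ∨ 1 < n := by lia
  · exact ⟨A, 𝟙 A, f, hleft A hA (fun i _ _ => by lia), Category.id_comp f⟩
  · obtain ⟨S, hS, rfl, ⟨hM₀, hf⟩, hG'⟩ := hG A hA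
    have h1 := subsingleton_ext_of_left_coresolution hG hPP hleft hX 1 hn S.X₃ hG'
      (fun i hi hi' Y hY => by
        obtain rfl : i = 1 := by lia
        exact subsingleton_ext_one_of_extension hS (hPP _ _ hM₀ hY _ le_rfl hn) (hf Y hY))
      1 le_rfl le_rfl
    obtain ⟨g, hg⟩ := exists_extension_of_subsingleton_ext hS h1 f
    exact ⟨S.X₂, S.f, g, hM₀, hg⟩

end Homological

/-! ### Add and add in terms of linear maps -/

lemma exists_biprod_iso_iff {C : Type u} [Category.{v} C] [Abelian C] (X W : C) :
    (∃ Z, Nonempty (X ⊞ Z ≅ W)) ↔ ∃ (s : X ⟶ W) (r : W ⟶ X), s ≫ r = 𝟙 X := by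
  constructor
  · rintro ⟨Z, ⟨e⟩⟩
    exact ⟨biprod.inl ≫ e.hom, e.inv ≫ biprod.fst, by simp⟩
  · rintro ⟨s, r, h⟩
    have : IsSplitMono s := ⟨⟨r, h⟩⟩
    exact ⟨_, ⟨(biprod.uniqueUpToIso X _ (isBilimitBinaryBiconeOfIsSplitMonoOfCokernel
      (cokernelIsCokernel s))).symm⟩⟩

lemma exists_retract_of_iso_iff {C : Type u} [Category.{v} C] {X W W' : C} (e : W ≅ W') :
    (∃ (s : X ⟶ W) (r : W ⟶ X), s ≫ r = 𝟙 X) ↔ ∃ (s : X ⟶ W') (r : W' ⟶ X), s ≫ r = 𝟙 X :=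
  ⟨fun ⟨s, r, h⟩ => ⟨s ≫ e.hom, e.inv ≫ r, by simpa using h⟩,
    fun ⟨s, r, h⟩ => ⟨s ≫ e.inv, e.hom ≫ r, by simpa using h⟩⟩

section Dictionary

variable {Λ : Type u} [Ring Λ]

/-- The cofan exhibiting `J →₀ M` as a coproduct of copies of `M`. -/
noncomputable def finsuppCofan (M J : Type u) [AddCommGroup M] [Module Λ M] :
    Cofan fun _ : J => ModuleCat.of Λ M :=
  Cofan.mk (ModuleCat.of Λ (J →₀ M)) fun j => ModuleCat.ofHom (Finsupp.lsingle j)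

/-- The cofan `finsuppCofan M J` is a coproduct. -/
noncomputable def finsuppCofanIsColimit (M J : Type u) [AddCommGroup M] [Module Λ M] :
    IsColimit (finsuppCofan (Λ := Λ) M J) :=
  Cofan.IsColimit.mk _
    (fun t => ModuleCat.ofHom (Finsupp.lsum ℕ fun j => (t.inj j).hom))
    (fun t j => by
      ext x
      change Finsupp.lsum ℕ _ (Finsupp.single j x) = _
      simp)
    (fun t m h => by
      refine ModuleCat.hom_ext (Finsupp.lhom_ext' fun j => ?_)
      ext x
      have := congrArg (fun f => f.hom x) (h j)
      change _ = Finsupp.lsum ℕ _ (Finsupp.single j x)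
      rw [Finsupp.lsum_single]
      exact this)

lemma bigAdd_iff (M : Type u) [AddCommGroup M] [Module Λ M] (X : ModuleCat.{u} Λ) :
    BigAdd (ObjectProperty.singleton (ModuleCat.of Λ M)) X ↔ IsBigAddSummand Λ M X := by
  have key : BigAdd (ObjectProperty.singleton (ModuleCat.of Λ M)) X ↔
      ∃ J : Type u, ∃ (s : X ⟶ ModuleCat.of Λ (J →₀ M)) (r : ModuleCat.of Λ (J →₀ M) ⟶ X),
        s ≫ r = 𝟙 X := by
    have e (J : Type u) : (∐ fun _ : J => ModuleCat.of Λ M) ≅ ModuleCat.of Λ (J →₀ M) :=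
      (coproductIsCoproduct _).coconePointUniqueUpToIso (finsuppCofanIsColimit M J)
    constructor
    · rintro ⟨Z, J, Y, hY, h⟩
      obtain rfl : (fun _ => ModuleCat.of Λ M) = Y :=
        funext fun j => (ObjectProperty.singleton_iff _ _).1 (hY j)
      exact ⟨J, (exists_retract_of_iso_iff (e J)).1 ((exists_biprod_iso_iff _ _).1 ⟨Z, h⟩)⟩
    · rintro ⟨J, h⟩
      obtain ⟨Z, hZ⟩ := (exists_biprod_iso_iff _ _).2 ((exists_retract_of_iso_iff (e J)).2 h)
      exact ⟨Z, J, _, fun _ => (ObjectProperty.singleton_iff _ _).2 rfl, hZ⟩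
  rw [key]
  constructor
  · rintro ⟨J, s, r, h⟩
    exact ⟨J, s.hom, r.hom, by rw [← ModuleCat.hom_comp, h, ModuleCat.hom_id]⟩
  · rintro ⟨J, s, r, h⟩
    exact ⟨J, ModuleCat.ofHom s, ModuleCat.ofHom r, ModuleCat.hom_ext h⟩

lemma IsSmallAddSummand.isBigAddSummand {M X : Type u} [AddCommGroup M] [Module Λ M]
    [AddCommGroup X] [Module Λ X] (h : IsSmallAddSummand Λ M X) : IsBigAddSummand Λ M X := by
  obtain ⟨k, s, r, h⟩ := h
  let e : (ULift.{u} (Fin k) →₀ M) ≃ₗ[Λ] (Fin k → M) :=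
    Finsupp.domLCongr Equiv.ulift ≪≫ₗ Finsupp.linearEquivFunOnFinite Λ M (Fin k)
  refine ⟨ULift.{u} (Fin k), e.symm.toLinearMap ∘ₗ s, r ∘ₗ e.toLinearMap, ?_⟩
  ext x
  simpa using LinearMap.congr_fun h x

/-- A map from a finitely generated module to a direct sum involves finitely many summands only. -/
lemma exists_finset_factorization {M X : Type u} {J : Type*} [AddCommGroup M] [Module Λ M]
    [AddCommGroup X] [Module Λ X] [Module.Finite Λ X] (s : X →ₗ[Λ] (J →₀ M)) :
    ∃ (k : ℕ) (a : X →ₗ[Λ] (Fin k → M)) (b : (Fin k → M) →ₗ[Λ] (J →₀ M)), b ∘ₗ a = s := by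
  classical
  obtain ⟨t, ht⟩ := Module.Finite.fg_top (R := Λ) (M := X)
  let T : Finset J := t.biUnion fun x => (s x).support
  have hT : ∀ x, (s x).support ⊆ T := by
    have : (⊤ : Submodule Λ X) ≤ (Finsupp.supported M Λ (T : Set J)).comap s := by
      rw [← ht, Submodule.span_le]
      intro x hx
      rw [SetLike.mem_coe, Submodule.mem_comap, Finsupp.mem_supported, Finset.coe_subset]
      exact Finset.subset_biUnion_of_mem (fun x => (s x).support) hx
    intro x
    have := this (Submodule.mem_top (x := x))
    rwa [Submodule.mem_comap, Finsupp.mem_supported, Finset.coe_subset] at this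
  let e := T.equivFin
  refine ⟨T.card, LinearMap.pi fun i => Finsupp.lapply (e.symm i : J) ∘ₗ s,
    ∑ i, Finsupp.lsingle (e.symm i : J) ∘ₗ LinearMap.proj i, ?_⟩
  ext1 x
  simp only [LinearMap.comp_apply, LinearMap.sum_apply, LinearMap.proj_apply, LinearMap.pi_apply,
    Finsupp.lapply_apply, Finsupp.lsingle_apply]
  rw [Equiv.sum_comp e.symm fun j : T => Finsupp.single (j : J) (s x j),
    Finset.sum_coe_sort T fun j => Finsupp.single j (s x j)]
  exact (Finsupp.sum_of_support_subset _ (hT x) _ (by simp)).symm.trans (s x).sum_single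

lemma IsBigAddSummand.isSmallAddSummand {M X : Type u} [AddCommGroup M] [Module Λ M]
    [AddCommGroup X] [Module Λ X] [Module.Finite Λ X] (h : IsBigAddSummand Λ M X) :
    IsSmallAddSummand Λ M X := by
  obtain ⟨J, s, r, h⟩ := h
  obtain ⟨k, a, b, rfl⟩ := exists_finset_factorization s
  exact ⟨k, a, r ∘ₗ b, by rw [LinearMap.comp_assoc, h]⟩

lemma isSmallAddSummand_pi (M : Type u) [AddCommGroup M] [Module Λ M] (k : ℕ) :
    IsSmallAddSummand Λ M (Fin k → M) := ⟨k, .id, .id, rfl⟩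

lemma isSmallAddSummand_self (M : Type u) [AddCommGroup M] [Module Λ M] :
    IsSmallAddSummand Λ M M :=
  ⟨1, LinearMap.pi fun _ => LinearMap.id, LinearMap.proj 0, rfl⟩

variable [IsNoetherianRing Λ]

/-- The cofan exhibiting `Fin k → M` as a coproduct of copies of `M` among the finitely generated
modules. -/
def piCofan (M : Type u) [AddCommGroup M] [Module Λ M] [Module.Finite Λ M] (k : ℕ) :
    Cofan fun _ : Fin k => FGModuleCat.of Λ M :=
  Cofan.mk (FGModuleCat.of Λ (Fin k → M)) fun j =>
    FGModuleCat.ofHom (LinearMap.single Λ (fun _ => M) j)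

/-- The cofan `piCofan M k` is a coproduct. -/
noncomputable def piCofanIsColimit (M : Type u) [AddCommGroup M] [Module Λ M]
    [Module.Finite Λ M] (k : ℕ) : IsColimit (piCofan (Λ := Λ) M k) :=
  Cofan.IsColimit.mk _
    (fun t => FGModuleCat.ofHom (LinearMap.lsum Λ (fun _ => M) ℕ fun j => (t.inj j).hom.hom))
    (fun t j => by
      refine FGModuleCat.hom_ext ?_
      ext x
      exact LinearMap.lsum_piSingle ..)
    (fun t m h => by
      refine FGModuleCat.hom_ext (LinearMap.pi_ext' fun j => ?_)
      ext x
      exact (congrArg (fun f => f.hom.hom x) (h j)).trans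
        (LinearMap.lsum_piSingle Λ (fun _ => M) ℕ (fun j => (t.inj j).hom.hom) j x).symm)

lemma smallAdd_iff (M : Type u) [AddCommGroup M] [Module Λ M] [Module.Finite Λ M]
    (X : FGModuleCat.{u} Λ) :
    SmallAdd (ObjectProperty.singleton (FGModuleCat.of Λ M)) X ↔ IsSmallAddSummand Λ M X := by
  have key : SmallAdd (ObjectProperty.singleton (FGModuleCat.of Λ M)) X ↔
      ∃ k : ℕ, ∃ (s : X ⟶ FGModuleCat.of Λ (Fin k → M)) (r : FGModuleCat.of Λ (Fin k → M) ⟶ X),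
        s ≫ r = 𝟙 X := by
    have e (k : ℕ) : (∐ fun _ : Fin k => FGModuleCat.of Λ M) ≅ FGModuleCat.of Λ (Fin k → M) :=
      (coproductIsCoproduct _).coconePointUniqueUpToIso (piCofanIsColimit M k)
    constructor
    · rintro ⟨Z, k, Y, hY, h⟩
      obtain rfl : (fun _ => FGModuleCat.of Λ M) = Y :=
        funext fun j => (ObjectProperty.singleton_iff _ _).1 (hY j)
      exact ⟨k, (exists_retract_of_iso_iff (e k)).1 ((exists_biprod_iso_iff _ _).1 ⟨Z, h⟩)⟩
    · rintro ⟨k, h⟩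
      obtain ⟨Z, hZ⟩ := (exists_biprod_iso_iff _ _).2 ((exists_retract_of_iso_iff (e k)).2 h)
      exact ⟨Z, k, _, fun _ => (ObjectProperty.singleton_iff _ _).2 rfl, hZ⟩
  rw [key]
  constructor
  · rintro ⟨k, s, r, h⟩
    exact ⟨k, s.hom.hom, r.hom.hom, by rw [← FGModuleCat.hom_hom_comp, h]; rfl⟩
  · rintro ⟨k, s, r, h⟩
    exact ⟨k, FGModuleCat.ofHom s, FGModuleCat.ofHom r, FGModuleCat.hom_ext h⟩

end Dictionary

/-! ### Vanishing of Ext on Add and add -/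

section Ext

variable {Λ : Type u} [Ring Λ]

lemma subsingleton_ext_bigAdd_left {M X : Type u} [AddCommGroup M] [Module Λ M] [AddCommGroup X]
    [Module Λ X] (hX : IsBigAddSummand Λ M X) {Y : ModuleCat.{u} Λ} {i : ℕ} (hi : 1 ≤ i)
    (h : Subsingleton (Ext.{u} (ModuleCat.of Λ M) Y i)) :
    Subsingleton (Ext.{u} (ModuleCat.of Λ X) Y i) := by
  obtain ⟨i, rfl⟩ := Nat.exists_eq_add_of_le' hi
  obtain ⟨J, s, r, hsr⟩ := hX
  exact subsingleton_ext_of_retract_left (s := ModuleCat.ofHom s) (r := ModuleCat.ofHom r)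
    (ModuleCat.hom_ext hsr)
    (subsingleton_ext_cofan (finsuppCofanIsColimit M J) i Y fun _ => h)

lemma subsingleton_ext_pi {M J : Type u} [AddCommGroup M] [Module Λ M]
    {Y : ModuleCat.{u} Λ} {i : ℕ} (hi : 1 ≤ i)
    (h : Subsingleton (Ext.{u} Y (ModuleCat.of Λ M) i)) :
    Subsingleton (Ext.{u} Y (ModuleCat.of Λ (J → M)) i) := by
  obtain ⟨i, rfl⟩ := Nat.exists_eq_add_of_le' hi
  exact subsingleton_ext_fan (ModuleCat.productConeIsLimit fun _ : J => ModuleCat.of Λ M) i Y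
    fun _ => h

/-- A direct sum of copies of `M` is pure in the product, hence a direct summand of it. This makes
`Ext(Y, -)` accessible on Add(M), since it commutes with products but in general not with direct
sums. -/
lemma IsBigAddSummand.exists_retract_pi [IsNoetherianRing Λ] {M X : Type u} [AddCommGroup M]
    [Module Λ M] [AddCommGroup X] [Module Λ X] (hM : HasStationaryEvals Λ M)
    (hX : IsBigAddSummand Λ M X) :
    ∃ (J : Type u) (s : X →ₗ[Λ] (J → M)) (r : (J → M) →ₗ[Λ] X), r ∘ₗ s = LinearMap.id := by
  obtain ⟨J, s, r, hsr⟩ := hX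
  obtain ⟨ρ, hρ⟩ := (isPureMono_finsupp_pi (Λ := Λ) M J).exists_retraction (hM.finsupp J)
  refine ⟨J, Finsupp.lcoeFun ∘ₗ s, r ∘ₗ ρ, ?_⟩
  rw [LinearMap.comp_assoc, ← LinearMap.comp_assoc s, hρ, LinearMap.id_comp, hsr]

lemma subsingleton_ext_bigAdd_right [IsNoetherianRing Λ] {M X : Type u} [AddCommGroup M]
    [Module Λ M] [AddCommGroup X] [Module Λ X] (hM : HasStationaryEvals Λ M)
    (hX : IsBigAddSummand Λ M X) {Y : ModuleCat.{u} Λ} {i : ℕ} (hi : 1 ≤ i)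
    (h : Subsingleton (Ext.{u} Y (ModuleCat.of Λ M) i)) :
    Subsingleton (Ext.{u} Y (ModuleCat.of Λ X) i) := by
  obtain ⟨J, s, r, hsr⟩ := hX.exists_retract_pi hM
  exact subsingleton_ext_of_retract_right (s := ModuleCat.ofHom s) (r := ModuleCat.ofHom r)
    (ModuleCat.hom_ext hsr) (subsingleton_ext_pi hi h)

/-- The inclusion of the finitely generated modules is exact, fully faithful and preserves
projectives, so it induces isomorphisms on `Ext`. -/
lemma subsingleton_ext_fgModuleCat_iff [IsNoetherianRing Λ] (X Y : FGModuleCat.{u} Λ) (i : ℕ) :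
    Subsingleton (Ext.{u} X Y i) ↔ Subsingleton (Ext.{u} X.obj Y.obj i) := by
  have : (forget₂ (FGModuleCat.{u} Λ) (ModuleCat.{u} Λ)).Additive := ⟨rfl⟩
  have : (forget₂ (FGModuleCat.{u} Λ) (ModuleCat.{u} Λ)).PreservesProjectiveObjects :=
      ⟨fun {P} hP => by
    obtain ⟨k, f, hf⟩ := Module.Finite.exists_fin' Λ P
    have hepi : Epi (FGModuleCat.ofHom f : FGModuleCat.of Λ (Fin k → Λ) ⟶ P) :=
      (forget₂ (FGModuleCat.{u} Λ) (ModuleCat.{u} Λ)).epi_of_epi_map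
        ((ModuleCat.epi_iff_surjective _).2 hf)
    have hs := Projective.factorThru_comp (𝟙 P)
      (FGModuleCat.ofHom f : FGModuleCat.of Λ (Fin k → Λ) ⟶ P)
    have : Module.Projective Λ P := Module.Projective.of_split
      (Projective.factorThru (𝟙 P) (FGModuleCat.ofHom f)).hom.hom f
      (congrArg (fun g => g.hom.hom) hs)
    exact (IsProjective.iff_projective P).1 this⟩
  have hbij := (forget₂ (FGModuleCat.{u} Λ)
    (ModuleCat.{u} Λ)).mapExt_bijective_of_preservesProjectiveObjects X Y i
  exact (Equiv.ofBijective _ hbij).subsingleton_congr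

end Ext

/-! ### Approximations of finitely generated modules -/

section Approximation

variable {Λ : Type u} [Ring Λ]

lemma finite_linearMap (R : Type w) [CommRing R] [Algebra R Λ] [IsNoetherianRing R]
    (X Y : Type u) [AddCommGroup X] [Module Λ X] [Module.Finite Λ X] [AddCommGroup Y]
    [Module Λ Y] [Module R Y] [IsScalarTower R Λ Y] [SMulCommClass Λ R Y] [Module.Finite R Y] :
    Module.Finite R (X →ₗ[Λ] Y) := by
  obtain ⟨k, p, hp⟩ := Module.Finite.exists_fin' Λ X
  let e : (X →ₗ[Λ] Y) →ₗ[R] (Fin k → Y) :=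
    { toFun := fun f i => f (p (Pi.single i 1))
      map_add' := fun _ _ => rfl
      map_smul' := fun _ _ => rfl }
  refine Module.Finite.of_injective e fun f g hfg => ?_
  refine (LinearMap.cancel_right hp).1 (LinearMap.pi_ext' fun i => LinearMap.ext_ring ?_)
  exact congrFun hfg i

/-- A finite generating set of `Hom(X, M)` over `R` assembles to a left add(M)-approximation. -/
lemma exists_leftApproximation (R : Type w) [CommRing R] [Algebra R Λ] [IsNoetherianRing R]
    (M X : Type u) [AddCommGroup X] [Module Λ X] [Module.Finite Λ X] [AddCommGroup M]
    [Module Λ M] [Module R M] [IsScalarTower R Λ M] [SMulCommClass Λ R M] [Module.Finite R M] :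
    ∃ (k : ℕ) (f : X →ₗ[Λ] (Fin k → M)), ∀ N : Type u, ∀ [AddCommGroup N] [Module Λ N],
      IsSmallAddSummand Λ M N → ∀ g : X →ₗ[Λ] N, ∃ h : (Fin k → M) →ₗ[Λ] N, h ∘ₗ f = g := by
  have := finite_linearMap (Λ := Λ) R X M
  obtain ⟨k, φ, hφ⟩ := Module.Finite.exists_fin (R := R) (M := X →ₗ[Λ] M)
  have key : ∀ g : X →ₗ[Λ] M, ∃ h : (Fin k → M) →ₗ[Λ] M, h ∘ₗ LinearMap.pi φ = g := by
    intro g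
    have hg : g ∈ Submodule.span R (Set.range φ) := hφ ▸ Submodule.mem_top
    obtain ⟨c, rfl⟩ := (Submodule.mem_span_range_iff_exists_fun R).1 hg
    refine ⟨∑ i, c i • LinearMap.proj i, ?_⟩
    ext x
    simp [LinearMap.sum_apply]
  refine ⟨k, LinearMap.pi φ, ?_⟩
  rintro N _ _ ⟨l, s, r, hsr⟩ g
  choose h hh using fun j => key (LinearMap.proj j ∘ₗ s ∘ₗ g)
  refine ⟨r ∘ₗ LinearMap.pi h, ?_⟩
  have : LinearMap.pi h ∘ₗ LinearMap.pi φ = s ∘ₗ g :=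
    LinearMap.ext fun x => funext fun j => LinearMap.congr_fun (hh j) x
  rw [LinearMap.comp_assoc, this, ← LinearMap.comp_assoc, hsr, LinearMap.id_comp]

/-- A finite generating set of `Hom(M, X)` over `R` assembles to a right add(M)-approximation. -/
lemma exists_rightApproximation (R : Type w) [CommRing R] [Algebra R Λ] [IsNoetherianRing R]
    (M X : Type u) [AddCommGroup M] [Module Λ M] [Module.Finite Λ M] [Module R M]
    [IsScalarTower R Λ M] [SMulCommClass Λ R M] [AddCommGroup X]
    [Module Λ X] [Module R X] [IsScalarTower R Λ X] [SMulCommClass Λ R X] [Module.Finite R X] :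
    ∃ (k : ℕ) (f : (Fin k → M) →ₗ[Λ] X), ∀ N : Type u, ∀ [AddCommGroup N] [Module Λ N],
      IsSmallAddSummand Λ M N → ∀ g : N →ₗ[Λ] X, ∃ h : N →ₗ[Λ] (Fin k → M), f ∘ₗ h = g := by
  have := finite_linearMap (Λ := Λ) R M X
  obtain ⟨k, φ, hφ⟩ := Module.Finite.exists_fin (R := R) (M := M →ₗ[Λ] X)
  let p : (Fin k → M) →ₗ[Λ] X := LinearMap.lsum Λ (fun _ => M) ℕ φ
  have key : ∀ g : M →ₗ[Λ] X, ∃ h : M →ₗ[Λ] (Fin k → M), p ∘ₗ h = g := by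
    intro g
    have hg : g ∈ Submodule.span R (Set.range φ) := hφ ▸ Submodule.mem_top
    obtain ⟨c, rfl⟩ := (Submodule.mem_span_range_iff_exists_fun R).1 hg
    refine ⟨LinearMap.pi fun i => c i • LinearMap.id, ?_⟩
    ext x
    simp only [p, LinearMap.comp_apply, LinearMap.lsum_apply, LinearMap.sum_apply,
      LinearMap.proj_apply, LinearMap.pi_apply, LinearMap.smul_apply, LinearMap.id_apply]
    refine Finset.sum_congr rfl fun i _ => ?_
    rw [← algebraMap_smul Λ (c i) x, map_smul, algebraMap_smul]
  refine ⟨k, p, ?_⟩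
  rintro N _ _ ⟨l, s, r, hsr⟩ g
  choose h hh using fun j => key (g ∘ₗ r ∘ₗ LinearMap.single Λ (fun _ => M) j)
  refine ⟨LinearMap.lsum Λ (fun _ => M) ℕ h ∘ₗ s, ?_⟩
  have : p ∘ₗ LinearMap.lsum Λ (fun _ => M) ℕ h = g ∘ₗ r :=
    LinearMap.pi_ext fun j x => by
      rw [LinearMap.comp_apply, LinearMap.lsum_piSingle]
      exact LinearMap.congr_fun (hh j) x
  rw [← LinearMap.comp_assoc, this, LinearMap.comp_assoc, hsr, LinearMap.comp_id]

end Approximation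

/-! ### Comparison of cluster tilting for Add and add -/

section Comparison

variable {Λ : Type u} [Ring Λ]

lemma forall_ext_from_bigAdd_iff {M : Type u} [AddCommGroup M] [Module Λ M]
    {X : ModuleCat.{u} Λ} {n : ℕ} :
    (∀ i, 1 ≤ i → i < n → ∀ Y, BigAdd (ObjectProperty.singleton (ModuleCat.of Λ M)) Y →
      Subsingleton (Ext.{u} Y X i)) ↔
    ∀ i, 1 ≤ i → i < n → Subsingleton (Ext.{u} (ModuleCat.of Λ M) X i) :=
  ⟨fun h i hi hin => h i hi hin _
      ((bigAdd_iff M _).2 (isSmallAddSummand_self M).isBigAddSummand),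
    fun h i hi hin Y hY => subsingleton_ext_bigAdd_left ((bigAdd_iff M Y).1 hY) hi (h i hi hin)⟩

variable [IsNoetherianRing Λ]

lemma forall_ext_to_bigAdd_iff {M : Type u} [AddCommGroup M] [Module Λ M]
    (hM : HasStationaryEvals Λ M) {X : ModuleCat.{u} Λ} {n : ℕ} :
    (∀ i, 1 ≤ i → i < n → ∀ Y, BigAdd (ObjectProperty.singleton (ModuleCat.of Λ M)) Y →
      Subsingleton (Ext.{u} X Y i)) ↔
    ∀ i, 1 ≤ i → i < n → Subsingleton (Ext.{u} X (ModuleCat.of Λ M) i) :=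
  ⟨fun h i hi hin => h i hi hin _
      ((bigAdd_iff M _).2 (isSmallAddSummand_self M).isBigAddSummand),
    fun h i hi hin Y hY =>
      subsingleton_ext_bigAdd_right hM ((bigAdd_iff M Y).1 hY) hi (h i hi hin)⟩

lemma forall_ext_from_smallAdd_iff {M : Type u} [AddCommGroup M] [Module Λ M]
    [Module.Finite Λ M] {X : FGModuleCat.{u} Λ} {n : ℕ} :
    (∀ i, 1 ≤ i → i < n → ∀ Y, SmallAdd (ObjectProperty.singleton (FGModuleCat.of Λ M)) Y →
      Subsingleton (Ext.{u} Y X i)) ↔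
    ∀ i, 1 ≤ i → i < n → Subsingleton (Ext.{u} (ModuleCat.of Λ M) X.obj i) :=
  ⟨fun h i hi hin => (subsingleton_ext_fgModuleCat_iff (FGModuleCat.of Λ M) X i).1
      (h i hi hin _ ((smallAdd_iff M _).2 (isSmallAddSummand_self M))),
    fun h i hi hin Y hY => (subsingleton_ext_fgModuleCat_iff Y X i).2
      (subsingleton_ext_bigAdd_left ((smallAdd_iff M Y).1 hY).isBigAddSummand hi (h i hi hin))⟩

lemma forall_ext_to_smallAdd_iff {M : Type u} [AddCommGroup M] [Module Λ M]
    [Module.Finite Λ M] (hM : HasStationaryEvals Λ M) {X : FGModuleCat.{u} Λ} {n : ℕ} :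
    (∀ i, 1 ≤ i → i < n → ∀ Y, SmallAdd (ObjectProperty.singleton (FGModuleCat.of Λ M)) Y →
      Subsingleton (Ext.{u} X Y i)) ↔
    ∀ i, 1 ≤ i → i < n → Subsingleton (Ext.{u} X.obj (ModuleCat.of Λ M) i) :=
  ⟨fun h i hi hin => (subsingleton_ext_fgModuleCat_iff X (FGModuleCat.of Λ M) i).1
      (h i hi hin _ ((smallAdd_iff M _).2 (isSmallAddSummand_self M))),
    fun h i hi hin Y hY => (subsingleton_ext_fgModuleCat_iff X Y i).2
      (subsingleton_ext_bigAdd_right hM ((smallAdd_iff M Y).1 hY).isBigAddSummand hi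
        (h i hi hin))⟩

lemma bigAdd_obj_iff_smallAdd {M : Type u} [AddCommGroup M] [Module Λ M] [Module.Finite Λ M]
    (X : FGModuleCat.{u} Λ) :
    BigAdd (ObjectProperty.singleton (ModuleCat.of Λ M)) X.obj ↔
      SmallAdd (ObjectProperty.singleton (FGModuleCat.of Λ M)) X := by
  rw [bigAdd_iff, smallAdd_iff]
  exact ⟨fun h => IsBigAddSummand.isSmallAddSummand (X := X) h, fun h => h.isBigAddSummand⟩

theorem isFunctoriallyFinite_smallAdd (R : Type w) [CommRing R] [Algebra R Λ]
    [IsArtinAlgebra R Λ] (M : Type u) [AddCommGroup M] [Module Λ M] [Module.Finite Λ M] :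
    IsFunctoriallyFinite (SmallAdd (ObjectProperty.singleton (FGModuleCat.of Λ M))) := by
  have : IsArtinianRing R := IsArtinAlgebra.artinian Λ
  have : Module.Finite R Λ := IsArtinAlgebra.finite
  let _ : Module R M := Module.compHom M (algebraMap R Λ)
  have : IsScalarTower R Λ M := .of_algebraMap_smul fun _ _ => rfl
  have : SMulCommClass Λ R M := IsScalarTower.to_smulCommClass'
  have : Module.Finite R M := Module.Finite.trans Λ M
  refine ⟨fun A => ?_, fun A => ?_⟩
  · obtain ⟨k, f, hf⟩ := exists_leftApproximation (Λ := Λ) R M A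
    refine ⟨FGModuleCat.of Λ (Fin k → M), FGModuleCat.ofHom f,
      (smallAdd_iff M _).2 (isSmallAddSummand_pi M k), fun N hN g => ?_⟩
    obtain ⟨h, hh⟩ := hf N ((smallAdd_iff M N).1 hN) g.hom.hom
    exact ⟨FGModuleCat.ofHom h, FGModuleCat.hom_ext hh⟩
  · let _ : Module R A := Module.compHom A (algebraMap R Λ)
    have : IsScalarTower R Λ A := .of_algebraMap_smul fun _ _ => rfl
    have : SMulCommClass Λ R A := IsScalarTower.to_smulCommClass'
    have : Module.Finite R A := Module.Finite.trans Λ A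
    obtain ⟨k, f, hf⟩ := exists_rightApproximation (Λ := Λ) R M A
    refine ⟨FGModuleCat.of Λ (Fin k → M), FGModuleCat.ofHom f,
      (smallAdd_iff M _).2 (isSmallAddSummand_pi M k), fun N hN g => ?_⟩
    obtain ⟨h, hh⟩ := hf N ((smallAdd_iff M N).1 hN) g.hom.hom
    exact ⟨FGModuleCat.ofHom h, FGModuleCat.hom_ext hh⟩

omit [IsNoetherianRing Λ] in
lemma hasStationaryEvals_of_isArtinAlgebra (R : Type w) [CommRing R] [Algebra R Λ]
    [IsArtinAlgebra R Λ] (M : Type u) [AddCommGroup M] [Module Λ M] [Module.Finite Λ M] :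
    HasStationaryEvals Λ M := by
  have : IsArtinianRing R := IsArtinAlgebra.artinian Λ
  have : Module.Finite R Λ := IsArtinAlgebra.finite
  let _ : Module R M := Module.compHom M (algebraMap R Λ)
  have : IsScalarTower R Λ M := .of_algebraMap_smul fun _ _ => rfl
  have : Module.Finite R M := Module.Finite.trans Λ M
  exact hasStationaryEvals_of_isArtinian R M

theorem isNClusterTilting_smallAdd_of_bigAdd (R : Type w) [CommRing R] [Algebra R Λ]
    [IsArtinAlgebra R Λ] {M : Type u} [AddCommGroup M] [Module Λ M] [Module.Finite Λ M] {n : ℕ}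
    (h : IsNClusterTilting.{u} n (BigAdd (ObjectProperty.singleton (ModuleCat.of Λ M)))) :
    IsNClusterTilting.{u} n (SmallAdd (ObjectProperty.singleton (FGModuleCat.of Λ M))) where
  generating X := by
    obtain ⟨Y, f, hY, hf⟩ := h.generating X.obj
    obtain ⟨J, s, r, hsr⟩ := (bigAdd_iff M Y).1 hY
    -- Lift generators of `X` to `M^(J)`; finitely many coordinates suffice.
    obtain ⟨l, p, hp⟩ := Module.Finite.exists_fin' Λ X
    have hfr : Function.Surjective (f.hom ∘ₗ r) :=
      ((ModuleCat.epi_iff_surjective f).1 hf).comp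
        (LinearMap.surjective_of_comp_eq_id s r hsr)
    obtain ⟨q, hq⟩ := Module.projective_lifting_property (f.hom ∘ₗ r) p hfr
    obtain ⟨k, a, b, rfl⟩ := exists_finset_factorization q
    have hsurj : Function.Surjective (f.hom ∘ₗ r ∘ₗ b) := fun x => by
      obtain ⟨y, rfl⟩ := hp x
      exact ⟨a y, LinearMap.congr_fun hq y⟩
    refine ⟨FGModuleCat.of Λ (Fin k → M), FGModuleCat.ofHom (f.hom ∘ₗ r ∘ₗ b),
      (smallAdd_iff M _).2 (isSmallAddSummand_pi M k), ?_⟩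
    exact (forget₂ (FGModuleCat.{u} Λ) (ModuleCat.{u} Λ)).epi_of_epi_map
      ((ModuleCat.epi_iff_surjective _).2 hsurj)
  cogenerating X := by
    obtain ⟨Y, f, hY, hf⟩ := h.cogenerating X.obj
    obtain ⟨J, s, r, hsr⟩ := (bigAdd_iff M Y).1 hY
    have hsf : Function.Injective (s ∘ₗ f.hom) :=
      (LinearMap.injective_of_comp_eq_id s r hsr).comp ((ModuleCat.mono_iff_injective f).1 hf)
    obtain ⟨k, a, b, hab⟩ := exists_finset_factorization (X := X) (s ∘ₗ f.hom)
    have hinj : Function.Injective a := by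
      rw [← hab] at hsf
      exact Function.Injective.of_comp hsf
    refine ⟨FGModuleCat.of Λ (Fin k → M), FGModuleCat.ofHom a,
      (smallAdd_iff M _).2 (isSmallAddSummand_pi M k), ?_⟩
    exact (forget₂ (FGModuleCat.{u} Λ) (ModuleCat.{u} Λ)).mono_of_mono_map
      ((ModuleCat.mono_iff_injective _).2 hinj)
  functoriallyFinite := isFunctoriallyFinite_smallAdd R M
  mem_iff_ext_left X := by
    rw [← bigAdd_obj_iff_smallAdd, h.mem_iff_ext_left, forall_ext_to_bigAdd_iff,
      forall_ext_to_smallAdd_iff]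
    all_goals exact hasStationaryEvals_of_isArtinAlgebra R M
  mem_iff_ext_right X := by
    rw [← bigAdd_obj_iff_smallAdd, h.mem_iff_ext_right, forall_ext_from_bigAdd_iff,
      forall_ext_from_smallAdd_iff]

/-- The right-hand `Ext` criterion for arbitrary modules. Every map from a finitely generated module
to `X` factors through add(M), by dimension shifting along coresolutions of the finitely generated
module; then `X` is a pure quotient of a direct sum of copies of `M`, which splits. -/
theorem bigAdd_of_ext_eq_zero {M : Type u} [AddCommGroup M] [Module Λ M] [Module.Finite Λ M]
    (hM : HasStationaryEvals Λ M) {n : ℕ} (hn : 1 ≤ n)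
    (h : IsNClusterTilting.{u} n (SmallAdd (ObjectProperty.singleton (FGModuleCat.of Λ M))))
    (X : ModuleCat.{u} Λ)
    (hX : ∀ i, 1 ≤ i → i < n → Subsingleton (Ext.{u} (ModuleCat.of Λ M) X i)) :
    BigAdd (ObjectProperty.singleton (ModuleCat.of Λ M)) X := by
  have hMM : ∀ i, 1 ≤ i → i < n →
      Subsingleton (Ext.{u} (ModuleCat.of Λ M) (ModuleCat.of Λ M) i) :=
    (forall_ext_to_smallAdd_iff hM (X := FGModuleCat.of Λ M)).1
      ((h.mem_iff_ext_left _).1 ((smallAdd_iff M _).2 (isSmallAddSummand_self M)))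
  rw [bigAdd_iff]
  refine isBigAddSummand_of_factors hM fun F hF => ?_
  have : Module.Finite Λ F := Module.Finite.iff_fg.2 hF
  have hG : ∀ A, ModuleCat.isFG Λ A → ∃ S : ShortComplex (ModuleCat.{u} Λ), S.ShortExact ∧
      S.X₁ = A ∧ IsLeftApproximation (fun Y : ModuleCat.{u} Λ => IsSmallAddSummand Λ M Y) S.f ∧
        ModuleCat.isFG Λ S.X₃ := by
    intro A hA
    have hA' : Module.Finite Λ A := (ModuleCat.isFG_iff _).1 hA
    obtain ⟨N, f, hN, hf⟩ := h.functoriallyFinite.1 (FGModuleCat.of Λ A)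
    obtain ⟨N', f', hN', hf'⟩ := h.cogenerating (FGModuleCat.of Λ A)
    have hmono : Mono f.hom := by
      obtain ⟨g, rfl⟩ := hf N' hN' f'
      have : Mono f := mono_of_mono f g
      exact inferInstanceAs (Mono ((forget₂ (FGModuleCat.{u} Λ) (ModuleCat.{u} Λ)).map f))
    have hN2 := (smallAdd_iff M N).1 hN
    refine ⟨ShortComplex.mk f.hom (ModuleCat.ofHom (LinearMap.range f.hom.hom).mkQ) ?_,
      { exact := ?_, mono_f := hmono, epi_g := inferInstance }, rfl, ⟨hN2, fun Y hY g => ?_⟩,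
      (ModuleCat.isFG_iff _).2 ?_⟩
    · refine ModuleCat.hom_ext (LinearMap.ext fun x => ?_)
      exact (Submodule.Quotient.mk_eq_zero _).2 ⟨x, rfl⟩
    · rw [ShortComplex.moduleCat_exact_iff_range_eq_ker]
      exact (Submodule.ker_mkQ _).symm
    · obtain ⟨k, s, r, hsr⟩ := hY
      obtain ⟨t, ht⟩ := hf (FGModuleCat.of Λ (Fin k → M))
        ((smallAdd_iff M _).2 (isSmallAddSummand_pi M k)) (FGModuleCat.ofHom (s ∘ₗ g.hom))
      refine ⟨ModuleCat.ofHom (r ∘ₗ t.hom.hom), ModuleCat.hom_ext ?_⟩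
      have h1 : t.hom.hom ∘ₗ f.hom.hom = s ∘ₗ g.hom := congrArg (fun g => g.hom.hom) ht
      change (r ∘ₗ t.hom.hom) ∘ₗ f.hom.hom = g.hom
      rw [LinearMap.comp_assoc, h1, ← LinearMap.comp_assoc, hsr, LinearMap.id_comp]
    · exact inferInstanceAs (Module.Finite Λ (N ⧸ LinearMap.range f.hom.hom))
  have hPP : ∀ Y Z : ModuleCat.{u} Λ, IsSmallAddSummand Λ M Y → IsSmallAddSummand Λ M Z →
      ∀ i, 1 ≤ i → i < n → Subsingleton (Ext.{u} Y Z i) := by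
    intro Y Z hY hZ i hi hin
    exact subsingleton_ext_bigAdd_left hY.isBigAddSummand hi
      (subsingleton_ext_bigAdd_right hM hZ.isBigAddSummand hi (hMM i hi hin))
  have hleft : ∀ A : ModuleCat.{u} Λ, ModuleCat.isFG Λ A →
      (∀ i, 1 ≤ i → i < n → ∀ Y : ModuleCat.{u} Λ, IsSmallAddSummand Λ M Y →
        Subsingleton (Ext.{u} A Y i)) → IsSmallAddSummand Λ M A := by
    intro A hA hAM
    have hA' : Module.Finite Λ A := (ModuleCat.isFG_iff _).1 hA
    exact (smallAdd_iff M (FGModuleCat.of Λ A)).1 ((h.mem_iff_ext_left _).2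
      ((forall_ext_to_smallAdd_iff hM).2 fun i hi hin =>
        hAM i hi hin (ModuleCat.of Λ M) (isSmallAddSummand_self M)))
  have hXP : ∀ i, 1 ≤ i → i < n → ∀ Y : ModuleCat.{u} Λ, IsSmallAddSummand Λ M Y →
      Subsingleton (Ext.{u} Y X i) := by
    intro i hi hin Y hY
    exact subsingleton_ext_bigAdd_left hY.isBigAddSummand hi (hX i hi hin)
  obtain ⟨B, a, b, ⟨k, s, r, hsr⟩, hab⟩ := exists_factorization_of_ext_eq_zero hn
    (P := fun Y : ModuleCat.{u} Λ => IsSmallAddSummand Λ M Y) (G := ModuleCat.isFG Λ)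
    (X := X) (A := ModuleCat.of Λ F) hG hPP hleft hXP ((ModuleCat.isFG_iff _).2 this)
    (ModuleCat.ofHom F.subtype)
  refine ⟨k, s ∘ₗ a.hom, b.hom ∘ₗ r, ?_⟩
  have h1 : b.hom ∘ₗ a.hom = F.subtype := by rw [← ModuleCat.hom_comp, hab]; rfl
  rw [LinearMap.comp_assoc, ← LinearMap.comp_assoc a.hom, hsr, LinearMap.id_comp, h1]

theorem isNClusterTilting_bigAdd_of_smallAdd {M : Type u} [AddCommGroup M] [Module Λ M]
    [Module.Finite Λ M] (hM : HasStationaryEvals Λ M) {n : ℕ} (hn : 1 ≤ n)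
    (h : IsNClusterTilting.{u} n (SmallAdd (ObjectProperty.singleton (FGModuleCat.of Λ M)))) :
    IsNClusterTilting.{u} n (BigAdd (ObjectProperty.singleton (ModuleCat.of Λ M))) := by
  have hright := bigAdd_of_ext_eq_zero hM hn h
  have hMM : ∀ i, 1 ≤ i → i < n →
      Subsingleton (Ext.{u} (ModuleCat.of Λ M) (ModuleCat.of Λ M) i) :=
    (forall_ext_to_smallAdd_iff hM (X := FGModuleCat.of Λ M)).1
      ((h.mem_iff_ext_left _).1 ((smallAdd_iff M _).2 (isSmallAddSummand_self M)))
  have hPP : ∀ X Y : ModuleCat.{u} Λ, BigAdd (ObjectProperty.singleton (ModuleCat.of Λ M)) X →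
      BigAdd (ObjectProperty.singleton (ModuleCat.of Λ M)) Y → ∀ i, 1 ≤ i → i < n →
        Subsingleton (Ext.{u} X Y i) := fun X Y hX hY i hi hin =>
    subsingleton_ext_bigAdd_left ((bigAdd_iff M X).1 hX) hi
      (subsingleton_ext_bigAdd_right hM ((bigAdd_iff M Y).1 hY) hi (hMM i hi hin))
  have happ : ∀ X : ModuleCat.{u} Λ, ∃ (Y : ModuleCat.{u} Λ) (f : Y ⟶ X),
      IsRightApproximation (BigAdd (ObjectProperty.singleton (ModuleCat.of Λ M))) f ∧ Epi f := by
    intro X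
    refine ⟨ModuleCat.of Λ ((M →ₗ[Λ] X) →₀ M), ModuleCat.ofHom (evalSum Λ M X),
      ⟨(bigAdd_iff M _).2 ⟨_, .id, .id, rfl⟩, fun N hN g => ?_⟩, ?_⟩
    · obtain ⟨J, s, r, hsr⟩ := (bigAdd_iff M N).1 hN
      let t : (J →₀ M) →ₗ[Λ] ((M →ₗ[Λ] X) →₀ M) :=
        Finsupp.lsum ℕ fun j => Finsupp.lsingle (g.hom ∘ₗ r ∘ₗ Finsupp.lsingle j)
      have ht : evalSum Λ M X ∘ₗ t = g.hom ∘ₗ r := by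
        ext j m
        simp [t, evalSum_single]
      refine ⟨ModuleCat.ofHom (t ∘ₗ s), ModuleCat.hom_ext ?_⟩
      change evalSum Λ M X ∘ₗ t ∘ₗ s = g.hom
      rw [← LinearMap.comp_assoc, ht, LinearMap.comp_assoc, hsr, LinearMap.comp_id]
    · rw [ModuleCat.epi_iff_surjective]
      intro x
      -- The cyclic submodule generated by `x` is a quotient of a summand of some `M^k`.
      obtain ⟨Y, f, hY, hf⟩ := h.generating (FGModuleCat.of Λ (Submodule.span Λ {x}))
      obtain ⟨k, s, r, hsr⟩ := (smallAdd_iff M Y).1 hY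
      have hf' : Epi ((forget₂ (FGModuleCat.{u} Λ) (ModuleCat.{u} Λ)).map f) := inferInstance
      obtain ⟨y, hy⟩ := (ModuleCat.epi_iff_surjective _).1 hf'
        ⟨x, Submodule.mem_span_singleton_self x⟩
      let g : (Fin k → M) →ₗ[Λ] X := (Submodule.span Λ {x}).subtype ∘ₗ f.hom.hom ∘ₗ r
      have hg : g (s y) = x := by
        have h1 : r (s y) = y := LinearMap.congr_fun hsr y
        change ((f.hom.hom (r (s y)) : Submodule.span Λ {x}) : X) = x
        rw [h1]
        exact congrArg Subtype.val hy
      obtain ⟨t, ht⟩ := exists_evalSum_comp_eq g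
      exact ⟨t (s y), (LinearMap.congr_fun ht (s y)).trans hg⟩
  refine ⟨fun X => ?_, fun X => ?_, ⟨fun X => ?_, fun X => ?_⟩, fun X => ?_, fun X => ?_⟩
  · obtain ⟨Y, f, hf, he⟩ := happ X
    exact ⟨Y, f, hf.1, he⟩
  -- Injective modules satisfy the right-hand criterion, so they lie in Add(M).
  · exact ⟨Injective.under X, Injective.ι X, hright _ fun i hi _ => by
      obtain ⟨i, rfl⟩ := Nat.exists_eq_add_of_le' hi
      exact Ext.subsingleton_of_injective _ _ _, inferInstance⟩
  -- The product of copies of `M` lies in Add(M) by the right-hand criterion.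
  · refine ⟨ModuleCat.of Λ ((X →ₗ[Λ] M) → M), ModuleCat.ofHom (LinearMap.pi fun f => f),
      hright _ fun i hi hin => subsingleton_ext_pi hi (hMM i hi hin), fun N hN g => ?_⟩
    obtain ⟨J, s, r, hsr⟩ := ((bigAdd_iff M N).1 hN).exists_retract_pi hM
    refine ⟨ModuleCat.ofHom (r ∘ₗ LinearMap.pi fun j =>
      LinearMap.proj (LinearMap.proj j ∘ₗ s ∘ₗ g.hom)), ModuleCat.hom_ext ?_⟩
    change r ∘ₗ s ∘ₗ g.hom = g.hom
    rw [← LinearMap.comp_assoc, hsr, LinearMap.id_comp]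
  · obtain ⟨Y, f, hf, he⟩ := happ X
    exact ⟨Y, f, hf⟩
  · refine ⟨fun hX i hi hin Y hY => hPP X Y hX hY i hi hin, fun hX => ?_⟩
    refine mem_of_ext_left_of_mem_of_ext_right (n := n) (fun {X Y} s r hsr hY => ?_) happ hPP
      (fun X hX => hright X (forall_ext_from_bigAdd_iff.1 hX)) (n - 1) (by lia) X
      (fun i hi hin => by lia) (fun i hi hin => hX i hi (by lia))
    obtain ⟨J, s', r', hsr'⟩ := (bigAdd_iff M Y).1 hY
    refine (bigAdd_iff M X).2 ⟨J, s' ∘ₗ s.hom, r.hom ∘ₗ r', ?_⟩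
    rw [LinearMap.comp_assoc, ← LinearMap.comp_assoc s.hom, hsr', LinearMap.id_comp,
      ← ModuleCat.hom_comp, hsr, ModuleCat.hom_id]
  · exact ⟨fun hX i hi hin Y hY => hPP Y X hY hX i hi hin,
      fun hX => hright X (forall_ext_from_bigAdd_iff.1 hX)⟩

end Comparison

end ClusterTilting

theorem mainTheorem2 (R : Type w) (Λ : Type u) [CommRing R] [Ring Λ] [Algebra R Λ]
    [ClusterTilting.IsArtinAlgebra R Λ]
    (M : Type u) [AddCommGroup M] [Module Λ M] [Module.Finite Λ M] (n : ℕ) (hn : 1 ≤ n) :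
    haveI : IsNoetherianRing Λ := ClusterTilting.IsArtinAlgebra.isNoetherianRing R Λ
    ClusterTilting.IsNClusterTilting.{u} n
        (ClusterTilting.BigAdd (ObjectProperty.singleton (ModuleCat.of Λ M))) ↔
      ClusterTilting.IsNClusterTilting.{u} n
        (ClusterTilting.SmallAdd (ObjectProperty.singleton (FGModuleCat.of Λ M))) := by
  have : IsNoetherianRing Λ := ClusterTilting.IsArtinAlgebra.isNoetherianRing R Λ
  exact ⟨ClusterTilting.isNClusterTilting_smallAdd_of_bigAdd R,
    ClusterTilting.isNClusterTilting_bigAdd_of_smallAdd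
      (ClusterTilting.hasStationaryEvals_of_isArtinAlgebra R M) hn⟩
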